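/- **Market.** There are $n$ buyers and $k\ge 1$ sellers. An order $\gamma$ is a subset of the sellers, and $D(\gamma,\gamma')=|\gamma\triangle\gamma'|/k$ is the normalized Hamming distance. Each order has a cost $c(\gamma)\in[0,1]$. In every round, random performance increases $P_i(\gamma)\in[0,1]$ and integrable externalities $E_{ij}(\gamma)$ (suffered by buyer $i$ when buyer $j\neq i$ orders $\gamma$) are realized, with $\sum_{j\ne i}E_{ji}(\gamma)\in[0,1]$ for all $i,\gamma$; moreover $c(\emptyset)=P_i(\emptyset)=0$. The vectors of all these quantities are independent and identically distributed over rounds; within a round they may be arbitrarily dependent. For $\alpha\in[0,1]$ and a profile $S=(\gamma_1,\dots,\gamma_n)$ of orders, the utility of buyer $i$ is $$U_i(S)=P_i(\gamma_i)-c(\gamma_i)-\sum_{j\ne i}E_{ij}(\gamma_j)-\alpha\Big(\sum_{j\ne i}E_{ji}(\gamma_i)-\sum_{j\ne i}E_{ij}(\gamma_j)\Big),$$ and her effective utility is $U_i^e(\gamma)=P_i(\gamma)-c(\gamma)-\alpha\sum_{j\neq i}E_{ji}(\gamma)$, with mean $\bar u_i^e(\gamma)$. **Closeness.** For a parameter $\lambda>0$,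 assume that every buyer $i$ has a maximizer $\gamma_i^d$ of $\bar u_i^e$ with $$\bar u_i^e(\gamma_i^d)-\bar u_i^e(\gamma)\in\big[\lambda(D(\gamma,\gamma_i^d)-\tfrac1k),\ \lambda D(\gamma,\gamma_i^d)\big]\quad\text{for every order }\gamma.$$ **Learning algorithm.** All buyers simultaneously run the following zooming algorithm over $T\ge2$ rounds. Buyer $i$ keeps an active set of orders, initialized with a single (possibly random) order. Let $n_t^i(\gamma)$ be the number of earlier rounds in which she ordered $\gamma$, let $c_t^i(\gamma)=\sqrt{12\log T/(n_t^i(\gamma)+1)}$, and let $\hat u_{i,t}^e(\gamma)$ be the empirical mean of the effective utilities she observed in those rounds ($0$ if there are none). In round $t$, if some order $\gamma$ is not covered, i.e. $\lambda D(\gamma,\gamma')>c_t^i(\gamma')$ for every active $\gamma'$, she adds one uncovered order to the active set; she then places an active order maximizing $\hat u_{i,t}^e(\gamma)+2c_t^i(\gamma)$. Which uncovered order is added and how ties are broken is arbitrary, possibly randomized, but may depend only on information that precedes the realizations of the round. Let $S^t$ be the profile ordered in round $t$, let $U_i^t$ denote the utility with the realizations of round $t$, let $S^*$ be a profile maximizing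 $\sum_i\mathbb E[U_i(S)]$, and let $$R_w(T)=\sum_{i=1}^n\mathbb E\Big[\sum_{t=1}^T\big(U_i^t(S^*)-U_i^t(S^t)\big)\Big]$$ be the expected online welfare regret. **Claim.** For every $\lambda>0$ there is a constant $C$, depending only on $\lambda$, such that for all $n$, all $k\ge1$, all $T\ge2$, and every market satisfying the closeness assumption with parameter $\lambda$ for $$\alpha=\max\Big(0,\ 1-\min\Big(\frac{k^2\sqrt{\log T}}{\sqrt T},\ \frac{k^3\,2^{3k/4}\log^2 T}{T}\Big)\Big),$$ if this $\alpha$ is used as the transaction parameter, then $$R_w(T)\le C\Big(nk^2\sqrt{T\log T}+nk^3\,2^{3k/4}\log^2 T\Big).$$ -/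

import Mathlib

open MeasureTheory ProbabilityTheory

noncomputable section

namespace DataMarkets

/-- A purchase order: the set of sellers (out of `k`) from which a buyer buys. -/
abbrev Order (k : ℕ) : Type := Finset (Fin k)

/-- A complete order profile of the `n` buyers. -/
abbrev Profile (n k : ℕ) : Type := Fin n → Order k

/-- The realization of all random quantities in one round of the market.
`x.1 i γ` is the performance increase `P_i(γ)`; `x.2 i j γ` is the negative externality
`E_ij(γ)` that buyer `i` suffers when buyer `j` orders `γ`
(the entries with `i = j` are never used). -/
abbrev Outcome (n k : ℕ) : Type :=
  (Fin n → Order k → ℝ) × (Fin n → Fin n → Order k → ℝ)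

/-- A data market with `n` buyers and `k` sellers: the posted costs, and the joint law of the
performance increases and externalities in one round. -/
structure DataMarket (n k : ℕ) where
  cost : Order k → ℝ
  law : Measure (Outcome n k)
  law_prob : IsProbabilityMeasure law
  cost_mem : ∀ γ, cost γ ∈ Set.Icc (0 : ℝ) 1
  cost_empty : cost ∅ = 0
  perf_mem : ∀ᵐ x ∂law, ∀ i γ, x.1 i γ ∈ Set.Icc (0 : ℝ) 1
  perf_empty : ∀ᵐ x ∂law, ∀ i, x.1 i ∅ = 0
  ext_integrable : ∀ i j γ, i ≠ j → Integrable (fun x : Outcome n k => x.2 i j γ) law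
  ext_sum_mem : ∀ᵐ x ∂law, ∀ i γ,
    ∑ j ∈ Finset.univ.erase i, x.2 j i γ ∈ Set.Icc (0 : ℝ) 1

/-- Normalized Hamming distance between two orders, viewed as `k`-bit strings. -/
def hammingD {k : ℕ} (γ γ' : Order k) : ℝ :=
  ((symmDiff γ γ').card : ℝ) / (k : ℝ)

/-- The transaction cost `α (∑_{j ≠ i} E_ji(S_i) - ∑_{j ≠ i} E_ij(S_j))` charged to buyer `i`. -/
def transactionCost {n k : ℕ} (α : ℝ) (x : Outcome n k) (S : Profile n k) (i : Fin n) : ℝ :=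
  α * (∑ j ∈ Finset.univ.erase i, x.2 j i (S i) - ∑ j ∈ Finset.univ.erase i, x.2 i j (S j))

namespace DataMarket

variable {n k : ℕ} (M : DataMarket n k)

/-- Net gain `G_i(γ) = P_i(γ) - c(γ)`. -/
def gain (x : Outcome n k) (i : Fin n) (γ : Order k) : ℝ :=
  x.1 i γ - M.cost γ

/-- Stochastic utility `U_i(S)`, transaction cost included. -/
def utility (α : ℝ) (x : Outcome n k) (S : Profile n k) (i : Fin n) : ℝ :=
  M.gain x i (S i) - ∑ j ∈ Finset.univ.erase i, x.2 i j (S j) - transactionCost α x S i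

/-- Expected utility of buyer `i` at the profile `S`. -/
def expUtility (α : ℝ) (S : Profile n k) (i : Fin n) : ℝ :=
  ∫ x, M.utility α x S i ∂M.law

/-- Expected social welfare of the profile `S`. -/
def welfare (α : ℝ) (S : Profile n k) : ℝ :=
  ∑ i, M.expUtility α S i

/-- `S` maximizes the expected social welfare among all profiles. -/
def IsWelfareOptimal (α : ℝ) (S : Profile n k) : Prop :=
  ∀ S' : Profile n k, M.welfare α S' ≤ M.welfare α S

/-- Stochastic effective utility `U^e_i(γ) = G_i(γ) - α ∑_{j ≠ i} E_ji(γ)`. -/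
def effUtility (α : ℝ) (x : Outcome n k) (i : Fin n) (γ : Order k) : ℝ :=
  M.gain x i γ - α * ∑ j ∈ Finset.univ.erase i, x.2 j i γ

/-- Expected effective utility. -/
def expEffUtility (α : ℝ) (i : Fin n) (γ : Order k) : ℝ :=
  ∫ x, M.effUtility α x i γ ∂M.law

/-- `γ` maximizes the expected effective utility of buyer `i`. -/
def IsDominant (α : ℝ) (i : Fin n) (γ : Order k) : Prop :=
  ∀ γ' : Order k, M.expEffUtility α i γ' ≤ M.expEffUtility α i γ

/-- Closeness with parameter `lam`: every buyer has a maximizer `γd` of the expected effective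
utility such that the gap of any order `γ` to `γd` lies in
`[lam (D(γ, γd) - 1/k), lam D(γ, γd)]`. -/
def Closeness (α lam : ℝ) : Prop :=
  ∀ i, ∃ γd, M.IsDominant α i γd ∧ ∀ γ,
    M.expEffUtility α i γd - M.expEffUtility α i γ ∈
      Set.Icc (lam * (hammingD γ γd - 1 / (k : ℝ))) (lam * hammingD γ γd)

end DataMarket

/-! The zooming algorithm. Below `o t` is the order of a fixed buyer in round `t` along one sample
path; rounds are numbered `1, 2, …, T`. -/

/-- Number of rounds among `1, …, t` in which `γ` has been ordered. -/
def pulls {k : ℕ} (o : ℕ → Order k) (t : ℕ) (γ : Order k) : ℕ :=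
  ((Finset.Icc 1 t).filter (fun s => o s = γ)).card

/-- Confidence radius `√(12 log T / (n_t(γ) + 1))`. -/
def confRadius {k : ℕ} (T : ℕ) (o : ℕ → Order k) (t : ℕ) (γ : Order k) : ℝ :=
  Real.sqrt (12 * Real.log T / ((pulls o t γ : ℝ) + 1))

/-- Empirical mean of the rewards `r s γ` over the rounds `s ≤ t` in which `γ` has been ordered
(`0` if there are none). -/
def empMean {k : ℕ} (r : ℕ → Order k → ℝ) (o : ℕ → Order k) (t : ℕ) (γ : Order k) : ℝ :=
  (∑ s ∈ (Finset.Icc 1 t).filter (fun s => o s = γ), r s γ) / (pulls o t γ : ℝ)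

/-- The upper confidence bound index. -/
def ucb {k : ℕ} (T : ℕ) (r : ℕ → Order k → ℝ) (o : ℕ → Order k) (t : ℕ) (γ : Order k) : ℝ :=
  empMean r o t γ + 2 * confRadius T o t γ

/-- `γ` is covered by some active order. -/
def IsCovered {k : ℕ} (lam : ℝ) (T : ℕ) (o : ℕ → Order k) (t : ℕ)
    (active : Finset (Order k)) (γ : Order k) : Prop :=
  ∃ γ' ∈ active, lam * hammingD γ γ' ≤ confRadius T o t γ'

/-- One buyer follows the zooming algorithm with horizon `T` along a sample path: `A 0` is the
initial active set and `A t` the active set used to select the order `o t` of round `t`. Which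
uncovered order is activated and how ties between indices are broken is arbitrary. -/
def FollowsZooming {k : ℕ} (lam : ℝ) (T : ℕ) (r : ℕ → Order k → ℝ)
    (A : ℕ → Finset (Order k)) (o : ℕ → Order k) : Prop :=
  (∃ γ, A 0 = {γ}) ∧
  ∀ t < T,
    (((∀ γ, IsCovered lam T o t (A t) γ) ∧ A (t + 1) = A t) ∨
      ∃ γ, ¬ IsCovered lam T o t (A t) γ ∧ A (t + 1) = insert γ (A t)) ∧
    o (t + 1) ∈ A (t + 1) ∧
    ∀ γ ∈ A (t + 1), ucb T r o t γ ≤ ucb T r o t (o (t + 1))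

/-- `T` rounds of the market `M` in which every buyer runs the zooming algorithm on her effective
utility. `ℱ t` is the information available after round `t` (`ℱ 0` holds the randomness of the
initialization; internal randomization of the buyers is allowed in every round). -/
structure ZoomingPlay {n k : ℕ} (M : DataMarket n k) (α lam : ℝ) (T : ℕ)
    {Ω : Type*} {mΩ : MeasurableSpace Ω} (μ : Measure Ω) where
  ℱ : Filtration ℕ mΩ
  /-- outcome of round `t` -/
  X : ℕ → Ω → Outcome n k
  /-- active set of buyer `i` -/
  A : ℕ → Ω → Fin n → Finset (Order k)
  /-- profile ordered in round `t` -/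
  S : ℕ → Ω → Profile n k
  /-- outcomes are observed at the end of their round, follow the market's law, and are independent
  of everything that happened before -/
  X_meas : ∀ t < T, Measurable[ℱ (t + 1)] (X (t + 1))
  X_law : ∀ t < T, μ.map (X (t + 1)) = M.law
  X_indep : ∀ t < T, Indep (MeasurableSpace.comap (X (t + 1)) inferInstance) (ℱ t) μ
  /-- the choices of round `t + 1` are made with the information available after round `t` -/
  A_zero_meas : ∀ i B, MeasurableSet[ℱ 0] {ω | A 0 ω i = B}
  A_meas : ∀ t < T, ∀ i B, MeasurableSet[ℱ t] {ω | A (t + 1) ω i = B}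
  S_meas : ∀ t < T, ∀ i γ, MeasurableSet[ℱ t] {ω | S (t + 1) ω i = γ}
  zooming : ∀ ω i,
    FollowsZooming lam T (fun t γ => M.effUtility α (X t ω) i γ)
      (fun t => A t ω i) (fun t => S t ω i)

/-- Expected online welfare regret with respect to the profile `Sopt`:
`∑_i E[∑_{t=1}^T (U_i(Sopt) - U_i(S^t))]`. -/
def ZoomingPlay.welfareRegret {n k : ℕ} {M : DataMarket n k} {α lam : ℝ} {T : ℕ}
    {Ω : Type*} {mΩ : MeasurableSpace Ω} {μ : Measure Ω}
    (Z : ZoomingPlay M α lam T μ) (Sopt : Profile n k) : ℝ :=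
  ∑ i, ∫ ω, ∑ t ∈ Finset.Icc 1 T,
    (M.utility α (Z.X t ω) Sopt i - M.utility α (Z.X t ω) (Z.S t ω) i) ∂μ

/-- The transaction parameter
`max(0, 1 - min(k² √(log T) / √T, k³ 2^(3k/4) log²(T) / T))`. -/
def alphaStar (k T : ℕ) : ℝ :=
  max 0 (1 - min ((k : ℝ) ^ 2 * Real.sqrt (Real.log T) / Real.sqrt T)
    ((k : ℝ) ^ 3 * (2 : ℝ) ^ (3 * (k : ℝ) / 4) * Real.log T ^ 2 / (T : ℝ)))

end DataMarkets

end

namespace DataMarkets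

/-! ### Packing bound for constant weight codes -/

/-! Transfers cancel in the sum over buyers, so total utility equals total effective utility minus
`1 - α` times the externalities caused. Each buyer causes between 0 and 1 per round, so the welfare
regret is at most the sum of the buyers' separate regrets in mean effective utility, plus `n (1 - α)
T` (`welfareRegret_le`). The choice of `α` makes the last term at most `n k² √(T log T)`. It remains
to bound one buyer's bandit regret.

Suppose every empirical mean lies within its confidence radius. An order placed then has gap at most
three radii, so an order of gap `Δ` is placed `O(log T / Δ²)` times, and every order's gap is at
most four radii at all times. An order is activated only if it is farther than the radius (in units
of `lam`) from every active order. With the lower half of closeness, active orders at Hamming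
distance `h` from the optimum `γd` are therefore pairwise at distance at least `h / 4`. Translating
by `γd` turns them into a code of constant weight `h`, which has at most `50 · 2^(3k/4)` words
(`card_constantWeight_le`). For `h ≥ 2` each order has gap at least `lam / k` and costs `O(k log T /
lam)`. For `h ≤ 1` closeness gives no positive lower bound on the gap, but there are at most `k`
orders per shell and each costs `O(√(T log T))`. This is `sum_gap_le_of_clean`.

A confidence bound fails with probability at most `4 · 2^k / T²`, by an exponential supermartingale
and a union bound. A failure costs at most `lam T`, which is acceptable once `T ≥ 2^(3k/4)`. For
smaller `T` the trivial regret `lam T` is already below the claimed bound. -/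

lemma ascFactorial_seven_le (m : ℕ) :
    15 * (7 * m + 8).ascFactorial 7 ≤ 8 * (8 * m + 9).ascFactorial 7 := by
  simp only [Nat.ascFactorial_eq_prod_range]
  -- Factor by factor, `(9 + i) / (8 + i) ≤ (8m + 9 + i) / (7m + 8 + i)`, with equality at `m = 0`.
  -- The product of the left sides is `15 / 8`.
  have h : (∏ i ∈ Finset.range 7, (9 + i)) * ∏ i ∈ Finset.range 7, (7 * m + 8 + i) ≤
      (∏ i ∈ Finset.range 7, (8 + i)) * ∏ i ∈ Finset.range 7, (8 * m + 9 + i) := by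
    rw [← Finset.prod_mul_distrib, ← Finset.prod_mul_distrib]
    exact Finset.prod_le_prod' fun i _ => by nlinarith [Nat.zero_le (m * i)]
  have e : 8 * ∏ i ∈ Finset.range 7, (9 + i) = 15 * ∏ i ∈ Finset.range 7, (8 + i) := by decide
  refine Nat.le_of_mul_le_mul_left (c := ∏ i ∈ Finset.range 7, (8 + i)) ?_
    (Finset.prod_pos fun i _ => by omega)
  generalize ∏ i ∈ Finset.range 7, (8 + i) = p at *
  generalize ∏ i ∈ Finset.range 7, (9 + i) = q at *
  generalize ∏ i ∈ Finset.range 7, (7 * m + 8 + i) = x at *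
  generalize ∏ i ∈ Finset.range 7, (8 * m + 9 + i) = y at *
  calc p * (15 * x) = (15 * p) * x := by ring
    _ = 8 * (q * x) := by rw [← e]; ring
    _ ≤ 8 * (p * y) := Nat.mul_le_mul_left _ h
    _ = _ := by ring

/-- After cancelling factorials the ratio of the two binomials is 8 times a quotient of seven-fold
rising products. The indices start at 1 because the ratio from 0 to 1 is only 8. -/
lemma choose_eight_mul_step (m : ℕ) :
    15 * (8 * (m + 1)).choose (m + 1) ≤ (8 * (m + 2)).choose (m + 2) := by
  have e1 := Nat.choose_mul_factorial_mul_factorial (show m + 1 ≤ 8 * (m + 1) by omega)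
  have e2 := Nat.choose_mul_factorial_mul_factorial (show m + 2 ≤ 8 * (m + 2) by omega)
  rw [show 8 * (m + 1) - (m + 1) = 7 * m + 7 by omega] at e1
  rw [show 8 * (m + 2) - (m + 2) = 7 * m + 7 + 7 by omega] at e2
  have f8 : (8 * (m + 2)).factorial =
      (8 * (m + 1)).factorial * (8 * (m + 2) * (8 * m + 9).ascFactorial 7) := by
    have h := Nat.factorial_mul_ascFactorial (8 * m + 8) 8
    rw [Nat.ascFactorial_succ, show 8 * m + 8 + 1 + 7 = 8 * (m + 2) by ring,
      show 8 * m + 8 + 1 = 8 * m + 9 by ring] at h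
    rw [show 8 * (m + 1) = 8 * m + 8 by ring]
    exact h.symm
  have f7 := Nat.factorial_mul_ascFactorial (7 * m + 7) 7
  rw [show 7 * m + 7 + 1 = 7 * m + 8 by ring] at f7
  rw [f8, ← f7, Nat.factorial_succ (m + 1), ← e1] at e2
  have ineq := ascFactorial_seven_le m
  have hp : 0 < (m + 1).factorial * (7 * m + 7).factorial * (m + 2) :=
    Nat.mul_pos (Nat.mul_pos (Nat.factorial_pos _) (Nat.factorial_pos _)) (by omega)
  have hx : 0 < (7 * m + 8).ascFactorial 7 := Nat.ascFactorial_pos _ _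
  generalize (8 * (m + 1)).choose (m + 1) = a at *
  generalize (8 * (m + 2)).choose (m + 2) = b at *
  generalize (7 * m + 8).ascFactorial 7 = x at *
  generalize (8 * m + 9).ascFactorial 7 = y at *
  generalize (m + 1).factorial = f at *
  generalize (7 * m + 7).factorial = g at *
  have key : b * x = 8 * y * a := by
    apply Nat.eq_of_mul_eq_mul_right hp
    linear_combination e2
  refine Nat.le_of_mul_le_mul_right ?_ hx
  calc 15 * a * x = (15 * x) * a := by ring
    _ ≤ (8 * y) * a := Nat.mul_le_mul_right _ ineq
    _ = b * x := key.symm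

/-- Each step multiplies the quantity by at least `15 z⁷ ≥ 1`. The induction starts at `m = 1`,
where `8 z⁷ ≥ 8/15`, and this is why the bound is `1/2` rather than 1. -/
lemma half_le_choose_eight_mul {z : ℝ} (hz : 0 ≤ z) (hz7 : 1 ≤ 15 * z ^ 7) (m : ℕ) :
    (1 / 2 : ℝ) ≤ ((8 * m).choose m : ℝ) * z ^ (7 * m) := by
  have succ_case : ∀ m : ℕ,
      (1 / 2 : ℝ) ≤ ((8 * (m + 1)).choose (m + 1) : ℝ) * z ^ (7 * (m + 1)) := by
    intro m
    induction m with
    | zero => simp only [zero_add, mul_one, Nat.choose_one_right]; push_cast; linarith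
    | succ m ih =>
      rw [show m + 1 + 1 = m + 2 from rfl]
      have h : ((15 * (8 * (m + 1)).choose (m + 1) : ℕ) : ℝ) ≤ (8 * (m + 2)).choose (m + 2) :=
        Nat.cast_le.2 (choose_eight_mul_step m)
      rw [Nat.cast_mul, Nat.cast_ofNat] at h
      generalize (8 * (m + 2)).choose (m + 2) = b at *
      generalize (8 * (m + 1)).choose (m + 1) = a at *
      calc (1 / 2 : ℝ) ≤ (a : ℝ) * z ^ (7 * (m + 1)) := ih
        _ ≤ ((a : ℝ) * z ^ (7 * (m + 1))) * (15 * z ^ 7) :=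
            le_mul_of_one_le_right (by positivity) hz7
        _ = (15 * a) * z ^ (7 * (m + 2)) := by
            rw [show 7 * (m + 2) = 7 * (m + 1) + 7 by ring, pow_add]; ring
        _ ≤ _ := mul_le_mul_of_nonneg_right h (pow_nonneg hz _)
  cases m with
  | zero => norm_num
  | succ m => exact succ_case m

/-- A single term of the binomial expansion of `(1 + z)^k` with `z = 17/25`. This `z` is large
enough for `15 z⁷ ≥ 1` and small enough for `1 + z ≤ 2^(3/4)`. -/
lemma choose_mul_pow_le (k s : ℕ) :
    (k.choose s : ℝ) * (17 / 25 : ℝ) ^ s ≤ (42 / 25 : ℝ) ^ k := by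
  rcases le_or_gt s k with h | h
  · rw [show (42 / 25 : ℝ) = 17 / 25 + 1 by norm_num, add_pow]
    have := Finset.single_le_sum (f := fun j => (17 / 25 : ℝ) ^ j * 1 ^ (k - j) * (k.choose j : ℝ))
      (s := Finset.range (k + 1)) (fun _ _ => by positivity) (Finset.mem_range.2 (by omega : s < k + 1))
    simp only [one_pow, mul_one] at this ⊢
    linarith
  · rw [Nat.choose_eq_zero_of_lt h]; simp; positivity

lemma pow_le_two_rpow (k : ℕ) : (42 / 25 : ℝ) ^ k ≤ (2 : ℝ) ^ (3 * (k : ℝ) / 4) := by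
  have h : (42 / 25 : ℝ) ≤ (2 : ℝ) ^ (3 / 4 : ℝ) := by
    have : ((42 / 25 : ℝ) ^ (4 : ℕ)) ≤ ((2 : ℝ) ^ (3 / 4 : ℝ)) ^ (4 : ℕ) := by
      rw [← Real.rpow_natCast ((2 : ℝ) ^ (3 / 4 : ℝ)), ← Real.rpow_mul (by norm_num)]
      norm_num
    exact le_of_pow_le_pow_left₀ (by norm_num) (by positivity) this
  calc (42 / 25 : ℝ) ^ k ≤ ((2 : ℝ) ^ (3 / 4 : ℝ)) ^ k := by gcongr
    _ = _ := by
      rw [← Real.rpow_natCast, ← Real.rpow_mul (by norm_num)]; congr 1; ring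

/-- Two different codewords of a constant weight code share no large subset. -/
lemma card_mul_choose_le {k : ℕ} (𝒞 : Finset (Finset (Fin k))) (h s : ℕ)
    (hcard : ∀ c ∈ 𝒞, c.card = h)
    (hsep : ∀ c ∈ 𝒞, ∀ c' ∈ 𝒞, c ≠ c' → (c ∩ c').card < s) :
    𝒞.card * h.choose s ≤ k.choose s := by
  have hdisj : (𝒞 : Set (Finset (Fin k))).PairwiseDisjoint (fun c => c.powersetCard s) := by
    intro c hc c' hc' hne
    refine Finset.disjoint_left.2 fun y hy hy' => ?_
    rw [Finset.mem_powersetCard] at hy hy'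
    have := Finset.card_le_card (Finset.subset_inter hy.1 hy'.1)
    have := hsep c hc c' hc' hne
    omega
  have h1 : (𝒞.biUnion fun c => c.powersetCard s).card = 𝒞.card * h.choose s := by
    rw [Finset.card_biUnion hdisj, Finset.sum_const_nat]
    intro c hc
    rw [Finset.card_powersetCard, hcard c hc]
  have h2 : (𝒞.biUnion fun c => c.powersetCard s) ⊆ (Finset.univ : Finset (Fin k)).powersetCard s := by
    intro y hy
    simp only [Finset.mem_biUnion, Finset.mem_powersetCard] at hy ⊢
    obtain ⟨c, -, -, hy⟩ := hy
    exact ⟨Finset.subset_univ _, hy⟩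
  rw [← h1]
  simpa using Finset.card_le_card h2

lemma card_symmDiff_add {α : Type*} [DecidableEq α] (c c' : Finset α) :
    (symmDiff c c').card + 2 * (c ∩ c').card = c.card + c'.card := by
  have hd : Disjoint (c \ c') (c' \ c) :=
    Finset.disjoint_left.2 fun x hx hx' => by simp_all
  have : (symmDiff c c').card = (c \ c').card + (c' \ c).card := by
    rw [← Finset.card_union_of_disjoint hd]; rfl
  have h1 := Finset.card_sdiff_add_card_inter c c'
  have h2 := Finset.card_sdiff_add_card_inter c' c
  rw [Finset.inter_comm c' c] at h2
  omega

/-- A code of constant weight `h` whose distances are at least `h / 4`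
has `O(2 ^ (3 k / 4))` codewords. -/
theorem card_constantWeight_le {k : ℕ} (𝒞 : Finset (Finset (Fin k))) (h : ℕ) (hh : 1 ≤ h)
    (hcard : ∀ c ∈ 𝒞, c.card = h)
    (hsep : ∀ c ∈ 𝒞, ∀ c' ∈ 𝒞, c ≠ c' → h ≤ 4 * (symmDiff c c').card) :
    (𝒞.card : ℝ) ≤ 50 * (2 : ℝ) ^ (3 * (k : ℝ) / 4) := by
  -- The largest `m` with `8 m < h`. Two codewords meet in at most `h - h/8 < h - m` points, so
  -- their families of `(h - m)`-subsets are disjoint.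
  obtain ⟨m, hm⟩ : ∃ m, m = (h - 1) / 8 := ⟨_, rfl⟩
  have hmh : 8 * m + 1 ≤ h := by omega
  have hhm : h ≤ 8 * m + 8 := by omega
  have h1 : 𝒞.card * h.choose (h - m) ≤ k.choose (h - m) := by
    refine card_mul_choose_le 𝒞 h (h - m) hcard fun c hc c' hc' hne => ?_
    have e := card_symmDiff_add c c'
    have := hsep c hc c' hc' hne
    rw [hcard c hc, hcard c' hc'] at e
    omega
  have h2 : (1 / 50 : ℝ) ≤ (h.choose (h - m) : ℝ) * (17 / 25 : ℝ) ^ (h - m) := by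
    have c1 : ((8 * m).choose m : ℝ) ≤ (h.choose (h - m) : ℝ) := by
      rw [Nat.choose_symm (by omega : m ≤ h)]
      exact_mod_cast Nat.choose_le_choose m (by omega)
    have c2 : (17 / 25 : ℝ) ^ (7 * m + 8) ≤ (17 / 25 : ℝ) ^ (h - m) :=
      pow_le_pow_of_le_one (by norm_num) (by norm_num) (by omega)
    have c3 := half_le_choose_eight_mul (z := 17 / 25) (by norm_num) (by norm_num) m
    calc (1 / 50 : ℝ) ≤ 1 / 2 * (17 / 25 : ℝ) ^ 8 := by norm_num
      _ ≤ (((8 * m).choose m : ℝ) * (17 / 25 : ℝ) ^ (7 * m)) * (17 / 25 : ℝ) ^ 8 := by gcongr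
      _ = ((8 * m).choose m : ℝ) * (17 / 25 : ℝ) ^ (7 * m + 8) := by rw [pow_add]; ring
      _ ≤ _ := by gcongr
  have h3 : (𝒞.card : ℝ) * (1 / 50) ≤ (2 : ℝ) ^ (3 * (k : ℝ) / 4) :=
    calc (𝒞.card : ℝ) * (1 / 50)
        ≤ 𝒞.card * ((h.choose (h - m) : ℝ) * (17 / 25 : ℝ) ^ (h - m)) := by gcongr
      _ = ((𝒞.card * h.choose (h - m) : ℕ) : ℝ) * (17 / 25 : ℝ) ^ (h - m) := by push_cast; ring
      _ ≤ (k.choose (h - m) : ℝ) * (17 / 25 : ℝ) ^ (h - m) := by gcongr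
      _ ≤ _ := (choose_mul_pow_le k _).trans (pow_le_two_rpow k)
  linarith

end DataMarkets

namespace DataMarkets

/-! ### Deterministic analysis of the zooming algorithm -/

section Path

variable {k T : ℕ} {lam : ℝ} {r : ℕ → Order k → ℝ} {A : ℕ → Finset (Order k)} {o : ℕ → Order k}

lemma log_ge_of_two_le (hT : 2 ≤ T) : (69 / 100 : ℝ) ≤ Real.log T := by
  have h1 := Real.log_two_gt_d9
  have h2 : Real.log 2 ≤ Real.log T := Real.log_le_log (by norm_num) (by exact_mod_cast hT)
  linarith

lemma pulls_succ (o : ℕ → Order k) (t : ℕ) (γ : Order k) :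
    pulls o (t + 1) γ = pulls o t γ + if o (t + 1) = γ then 1 else 0 := by
  unfold pulls
  rw [← Finset.insert_Icc_right_eq_Icc_add_one (by omega : 1 ≤ t + 1), Finset.filter_insert]
  split_ifs with h
  · rw [Finset.card_insert_of_notMem (by simp)]
  · simp

lemma pulls_le (o : ℕ → Order k) (t : ℕ) (γ : Order k) : pulls o t γ ≤ t := by
  unfold pulls
  simpa using Finset.card_filter_le (Finset.Icc 1 t) (fun s => o s = γ)

/-- The last round in which `γ` has been ordered. -/
lemma exists_last_pull (o : ℕ → Order k) (γ : Order k) (t : ℕ) (h : pulls o t γ ≠ 0) :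
    ∃ s < t, o (s + 1) = γ ∧ pulls o t γ = pulls o s γ + 1 := by
  induction t with
  | zero => simp [pulls] at h
  | succ t ih =>
    by_cases ho : o (t + 1) = γ
    · exact ⟨t, by omega, ho, by rw [pulls_succ, if_pos ho]⟩
    · rw [pulls_succ, if_neg ho, add_zero] at h ⊢
      obtain ⟨s, hs, h1, h2⟩ := ih h
      exact ⟨s, by omega, h1, h2⟩

lemma FollowsZooming.subset_succ (hz : FollowsZooming lam T r A o) {t : ℕ} (ht : t < T) :
    A t ⊆ A (t + 1) := by
  rcases (hz.2 t ht).1 with ⟨-, h⟩ | ⟨γ, -, h⟩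
  · rw [h]
  · rw [h]; exact Finset.subset_insert _ _

lemma FollowsZooming.subset (hz : FollowsZooming lam T r A o) {s t : ℕ} (hst : s ≤ t)
    (ht : t ≤ T) : A s ⊆ A t := by
  induction t, hst using Nat.le_induction with
  | base => exact Finset.Subset.refl _
  | succ t _ ih => exact (ih (by omega)).trans (hz.subset_succ (by omega))

lemma FollowsZooming.mem_of_pulls_ne_zero (hz : FollowsZooming lam T r A o) {t : ℕ} (ht : t ≤ T)
    {γ : Order k} (h : pulls o t γ ≠ 0) : γ ∈ A t := by
  obtain ⟨s, hs, rfl, -⟩ := exists_last_pull o γ t h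
  exact hz.subset (by omega : s + 1 ≤ t) ht (hz.2 s (by omega)).2.1

lemma hammingD_self (γ : Order k) : hammingD γ γ = 0 := by
  simp [hammingD]

lemma hammingD_comm (γ γ' : Order k) : hammingD γ γ' = hammingD γ' γ := by
  simp [hammingD, symmDiff_comm]

lemma hammingD_le_one (γ γ' : Order k) : hammingD γ γ' ≤ 1 := by
  unfold hammingD
  refine div_le_one_of_le₀ ?_ (by positivity)
  have := Finset.card_le_univ (symmDiff γ γ')
  simp only [Fintype.card_fin] at this
  exact_mod_cast this

lemma confRadius_nonneg (T : ℕ) (o : ℕ → Order k) (t : ℕ) (γ : Order k) :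
    0 ≤ confRadius T o t γ := Real.sqrt_nonneg _

lemma confRadius_sq (T : ℕ) (o : ℕ → Order k) (t : ℕ) (γ : Order k) :
    confRadius T o t γ ^ 2 = 12 * Real.log T / ((pulls o t γ : ℝ) + 1) := by
  unfold confRadius
  rw [Real.sq_sqrt]
  have := Real.log_natCast_nonneg T
  positivity

/-- All empirical means lie within their confidence radii. -/
def Clean (T : ℕ) (r : ℕ → Order k → ℝ) (o : ℕ → Order k) (u : Order k → ℝ) : Prop :=
  ∀ t < T, ∀ γ, |empMean r o t γ - u γ| ≤ confRadius T o t γ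

variable {u : Order k → ℝ} {γd : Order k}

lemma two_le_confRadius (hT : 2 ≤ T) {t : ℕ} {γ : Order k} (h : pulls o t γ ≤ 1) :
    2 ≤ confRadius T o t γ := by
  refine Real.le_sqrt_of_sq_le ?_
  have h1 := log_ge_of_two_le hT
  have h2 : (pulls o t γ : ℝ) ≤ 1 := by exact_mod_cast h
  rw [le_div_iff₀ (by positivity)]
  nlinarith

/-- An order placed in the clean case is at most three confidence radii from optimal. -/
lemma gap_le_confRadius (hz : FollowsZooming lam T r A o) (hc : Clean T r o u) (hT : 2 ≤ T)
    (hu1 : u γd ≤ 1) (hgap : ∀ γ, u γd - u γ ≤ lam * hammingD γ γd) {t : ℕ} (ht : t < T) :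
    u γd - u (o (t + 1)) ≤ 3 * confRadius T o t (o (t + 1)) := by
  obtain ⟨hA, -, hmax⟩ := hz.2 t ht
  have hplayed := (abs_le.1 (hc t ht (o (t + 1)))).2
  suffices h : ∃ γ ∈ A (t + 1), u γd ≤ ucb T r o t γ by
    obtain ⟨γ, hγ, h⟩ := h
    have := h.trans (hmax γ hγ)
    unfold ucb at this
    linarith
  -- Either an active order covers `γd`, and its index exceeds `u γd` by closeness; or an order has
  -- just been activated, possibly leaving `γd` uncovered. A newly activated order was never placed,
  -- since it would cover itself, so its empirical mean is the default 0 and its index is at least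
  -- `4 > u γd`.
  rcases hA with ⟨hcov, hA⟩ | ⟨γ, hγ, hA⟩
  · obtain ⟨γ, hγ, h⟩ := hcov γd
    refine ⟨γ, hA ▸ hγ, ?_⟩
    have h1 := (abs_le.1 (hc t ht γ)).1
    have h2 := hgap γ
    rw [hammingD_comm] at h2
    unfold ucb
    linarith
  · refine ⟨γ, hA ▸ Finset.mem_insert_self _ _, ?_⟩
    have hp : pulls o t γ = 0 := by
      by_contra hne
      refine hγ ⟨γ, hz.mem_of_pulls_ne_zero ht.le hne, ?_⟩
      rw [hammingD_self, mul_zero]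
      exact confRadius_nonneg _ _ _ _
    have h1 : 2 ≤ confRadius T o t γ := two_le_confRadius hT (by omega)
    have h2 : empMean r o t γ = 0 := by simp [empMean, hp]
    unfold ucb
    rw [h2]
    linarith

/-- Only the last round in which `γ` was placed matters. The count before it is one less, which
matches the `+ 1` in the radius; `108 = 9 · 12`. -/
lemma pulls_mul_gap_sq_le (hz : FollowsZooming lam T r A o) (hc : Clean T r o u) (hT : 2 ≤ T)
    (hu1 : u γd ≤ 1) (hdom : ∀ γ, u γ ≤ u γd) (hgap : ∀ γ, u γd - u γ ≤ lam * hammingD γ γd)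
    {t : ℕ} (ht : t ≤ T) (γ : Order k) :
    (pulls o t γ : ℝ) * (u γd - u γ) ^ 2 ≤ 108 * Real.log T := by
  by_cases h : pulls o t γ = 0
  · have := Real.log_natCast_nonneg T
    rw [h]
    simp
    positivity
  · obtain ⟨s, hs, rfl, hp⟩ := exists_last_pull o γ t h
    have h1 := gap_le_confRadius hz hc hT hu1 hgap (by omega : s < T)
    have h2 := confRadius_sq T o s (o (s + 1))
    have h3 : (u γd - u (o (s + 1))) ^ 2 ≤ 9 * confRadius T o s (o (s + 1)) ^ 2 := by
      have := hdom (o (s + 1))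
      nlinarith
    rw [h2] at h3
    have h4 : (0 : ℝ) < (pulls o s (o (s + 1)) : ℝ) + 1 := by positivity
    rw [hp]
    push_cast
    calc _ ≤ ((pulls o s (o (s + 1)) : ℝ) + 1) *
          (9 * (12 * Real.log T / ((pulls o s (o (s + 1)) : ℝ) + 1))) := by gcongr
      _ = _ := by field_simp; ring

/-- Passing from placed orders to all orders at all times costs a factor `4/3`: `108 / p ≤ 16 · 12 /
(p + 1)` once the count `p` is at least 2. For `p ≤ 1` the radius is at least 2, while gaps never
exceed 3. -/
lemma gap_le_four_mul_confRadius (hz : FollowsZooming lam T r A o) (hc : Clean T r o u)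
    (hT : 2 ≤ T) (hu1 : u γd ≤ 1) (hdom : ∀ γ, u γ ≤ u γd) (hu2 : ∀ γ, -2 ≤ u γ)
    (hgap : ∀ γ, u γd - u γ ≤ lam * hammingD γ γd)
    {t : ℕ} (ht : t ≤ T) (γ : Order k) :
    u γd - u γ ≤ 4 * confRadius T o t γ := by
  rcases Nat.lt_or_ge 1 (pulls o t γ) with h | h
  · have h1 := pulls_mul_gap_sq_le hz hc hT hu1 hdom hgap ht γ
    have h2 := confRadius_sq T o t γ
    have h3 : (2 : ℝ) ≤ pulls o t γ := by exact_mod_cast h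
    rw [eq_div_iff (by positivity)] at h2
    refine le_of_sq_le_sq ?_ (by have := confRadius_nonneg T o t γ; positivity)
    have h4 := sq_nonneg (u γd - u γ)
    have h5 := sq_nonneg (confRadius T o t γ)
    set p := (pulls o t γ : ℝ)
    have h6 : p * (u γd - u γ) ^ 2 ≤ p * (4 * confRadius T o t γ) ^ 2 := by nlinarith
    exact le_of_mul_le_mul_left h6 (by linarith)
  · have := two_le_confRadius (T := T) hT h
    linarith [hu2 γ]

/-- At the activation of `γ₀`, each active `γ` satisfies `lam D(γ₀, γ) > radius ≥ gap / 4 ≥ lam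
(D(γ, γd) - 1/k) / 4`. Multiplied by `k` this reads `4 |γ₀ ∆ γ| > h - 1`, so the slack `1/k`
disappears by integrality. -/
lemma separation_of_active (hz : FollowsZooming lam T r A o) (hc : Clean T r o u) (hk : 1 ≤ k)
    (hlam : 0 < lam) (hT : 2 ≤ T) (hu1 : u γd ≤ 1) (hdom : ∀ γ, u γ ≤ u γd)
    (hu2 : ∀ γ, -2 ≤ u γ) (hgap : ∀ γ, u γd - u γ ≤ lam * hammingD γ γd)
    (hgap' : ∀ γ, lam * (hammingD γ γd - 1 / (k : ℝ)) ≤ u γd - u γ) (h : ℕ) {t : ℕ}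
    (ht : t ≤ T) : ∀ γ ∈ A t, ∀ γ' ∈ A t, (symmDiff γ γd).card = h → (symmDiff γ' γd).card = h →
      γ ≠ γ' → h ≤ 4 * (symmDiff γ γ').card := by
  induction t with
  | zero =>
    obtain ⟨γ₀, h0⟩ := hz.1
    intro γ hγ γ' hγ' _ _ hne
    rw [h0, Finset.mem_singleton] at hγ hγ'
    exact absurd (hγ.trans hγ'.symm) hne
  | succ t ih =>
    have ih := ih (by omega)
    rcases (hz.2 t (by omega)).1 with ⟨-, hA⟩ | ⟨γ₀, hγ₀, hA⟩
    · rw [hA]; exact ih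
    · have key : ∀ γ ∈ A t, (symmDiff γ γd).card = h → h ≤ 4 * (symmDiff γ₀ γ).card := by
        intro γ hγ hh
        have h1 : confRadius T o t γ < lam * hammingD γ₀ γ := by
          by_contra hcon
          exact hγ₀ ⟨γ, hγ, not_lt.1 hcon⟩
        have h2 := gap_le_four_mul_confRadius hz hc hT hu1 hdom hu2 hgap (by omega : t ≤ T) γ
        have h3 := hgap' γ
        have h4 : lam * (hammingD γ γd - 1 / (k : ℝ)) < lam * (4 * hammingD γ₀ γ) := by linarith
        have h5 := lt_of_mul_lt_mul_left h4 hlam.le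
        have hk' : (0 : ℝ) < k := by exact_mod_cast hk
        unfold hammingD at h5
        rw [hh, ← sub_div, mul_div_assoc', div_lt_div_iff_of_pos_right hk'] at h5
        have h6 : (h : ℝ) < 4 * ((symmDiff γ₀ γ).card : ℝ) + 1 := by linarith
        have h7 : h < 4 * (symmDiff γ₀ γ).card + 1 := by exact_mod_cast h6
        omega
      intro γ hγ γ' hγ' hh hh' hne
      rw [hA, Finset.mem_insert] at hγ hγ'
      rcases hγ with rfl | hγ <;> rcases hγ' with rfl | hγ'
      · exact absurd rfl hne
      · exact key _ hγ' hh'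
      · rw [symmDiff_comm]; exact key _ hγ hh
      · exact ih _ hγ _ hγ' hh hh' hne

/-- Symmetric difference with `γd` is an isometry that sends the shell around `γd` to a constant
weight code. -/
lemma card_active_shell_le (hz : FollowsZooming lam T r A o) (hc : Clean T r o u) (hk : 1 ≤ k)
    (hlam : 0 < lam) (hT : 2 ≤ T) (hu1 : u γd ≤ 1) (hdom : ∀ γ, u γ ≤ u γd)
    (hu2 : ∀ γ, -2 ≤ u γ) (hgap : ∀ γ, u γd - u γ ≤ lam * hammingD γ γd)
    (hgap' : ∀ γ, lam * (hammingD γ γd - 1 / (k : ℝ)) ≤ u γd - u γ) {h : ℕ} (hh : 1 ≤ h) :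
    (((A T).filter fun γ => (symmDiff γ γd).card = h).card : ℝ) ≤
      50 * (2 : ℝ) ^ (3 * (k : ℝ) / 4) := by
  have hinj : Function.Injective (fun γ : Order k => symmDiff γ γd) := symmDiff_left_injective γd
  rw [← Finset.card_image_of_injective _ hinj]
  refine card_constantWeight_le _ h hh ?_ ?_
  · intro c hc
    simp only [Finset.mem_image, Finset.mem_filter] at hc
    obtain ⟨γ, ⟨-, hγ⟩, rfl⟩ := hc
    exact hγ
  · intro c hc₁ c' hc₂ hne
    simp only [Finset.mem_image, Finset.mem_filter] at hc₁ hc₂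
    obtain ⟨γ, ⟨hA, hγ⟩, rfl⟩ := hc₁
    obtain ⟨γ', ⟨hA', hγ'⟩, rfl⟩ := hc₂
    have e : symmDiff (symmDiff γ γd) (symmDiff γ' γd) = symmDiff γ γ' := by
      rw [symmDiff_comm γ' γd, symmDiff_assoc, symmDiff_symmDiff_cancel_left]
    rw [e]
    exact separation_of_active hz hc hk hlam hT hu1 hdom hu2 hgap hgap' h le_rfl γ hA γ' hA' hγ hγ'
      fun h => hne (by rw [h])

lemma card_shell_le (γd : Order k) (S : Finset (Order k)) (hk : 1 ≤ k) {h : ℕ} (hh : h < 2) :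
    (S.filter fun γ => (symmDiff γ γd).card = h).card ≤ k := by
  have hinj : Function.Injective (fun γ : Order k => symmDiff γ γd) := symmDiff_left_injective γd
  rw [← Finset.card_image_of_injective _ hinj]
  have hsub : (S.filter fun γ => (symmDiff γ γd).card = h).image (fun γ => symmDiff γ γd) ⊆
      (Finset.univ : Finset (Fin k)).powersetCard h := by
    intro c hc
    simp only [Finset.mem_image, Finset.mem_filter] at hc
    obtain ⟨γ, ⟨-, hγ⟩, rfl⟩ := hc
    simpa [Finset.mem_powersetCard] using hγ
  refine (Finset.card_le_card hsub).trans ?_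
  rw [Finset.card_powersetCard]
  interval_cases h <;> simp [hk]

lemma sum_order_eq_sum_pulls (hz : FollowsZooming lam T r A o) (f : Order k → ℝ) :
    ∑ t ∈ Finset.Icc 1 T, f (o t) = ∑ γ ∈ A T, (pulls o T γ : ℝ) * f γ := by
  have hmem : ∀ t ∈ Finset.Icc 1 T, o t ∈ A T := by
    intro t ht
    rw [Finset.mem_Icc] at ht
    obtain ⟨s, rfl⟩ : ∃ s, t = s + 1 := ⟨t - 1, by omega⟩
    exact hz.subset ht.2 le_rfl (hz.2 s (by omega)).2.1
  rw [← Finset.sum_fiberwise_of_maps_to hmem]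
  refine Finset.sum_congr rfl fun γ _ => ?_
  rw [Finset.sum_congr rfl (g := fun _ => f γ) (by
    intro t ht
    rw [(Finset.mem_filter.1 ht).2])]
  rw [Finset.sum_const, nsmul_eq_mul, pulls]

/-- Regret of the zooming algorithm along a sample path on which all confidence bounds hold. -/
theorem sum_gap_le_of_clean (hz : FollowsZooming lam T r A o) (hc : Clean T r o u) (hk : 1 ≤ k)
    (hlam : 0 < lam) (hT : 2 ≤ T) (hu1 : u γd ≤ 1) (hdom : ∀ γ, u γ ≤ u γd)
    (hu2 : ∀ γ, -2 ≤ u γ) (hgap : ∀ γ, u γd - u γ ≤ lam * hammingD γ γd)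
    (hgap' : ∀ γ, lam * (hammingD γ γd - 1 / (k : ℝ)) ≤ u γd - u γ) :
    ∑ t ∈ Finset.Icc 1 T, (u γd - u (o t)) ≤
      22 * (k : ℝ) * Real.sqrt (T * Real.log T) +
        10800 / lam * (k : ℝ) ^ 2 * Real.log T * (2 : ℝ) ^ (3 * (k : ℝ) / 4) := by
  have hL := log_ge_of_two_le hT
  have hk' : (1 : ℝ) ≤ k := by exact_mod_cast hk
  -- `B₁` bounds the loss of any one order, using `pulls ≤ T` and `√108 < 11`. `B₂` bounds it for
  -- orders at distance at least 2, whose gap is at least `lam / k`.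
  set B₁ : ℝ := 11 * Real.sqrt (T * Real.log T) with hB₁
  set B₂ : ℝ := 108 * Real.log T * k / lam with hB₂
  set Q : ℝ := 50 * (2 : ℝ) ^ (3 * (k : ℝ) / 4) with hQ
  have hQ0 : 0 ≤ Q := by positivity
  have hB₁0 : 0 ≤ B₁ := by positivity
  have hB₂0 : 0 ≤ B₂ := by positivity
  have near : ∀ γ, (pulls o T γ : ℝ) * (u γd - u γ) ≤ B₁ := by
    intro γ
    have h1 := pulls_mul_gap_sq_le hz hc hT hu1 hdom hgap le_rfl γ
    have h2 : (pulls o T γ : ℝ) ≤ T := by exact_mod_cast pulls_le o T γ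
    have h0 : (0 : ℝ) ≤ pulls o T γ := by positivity
    refine le_of_sq_le_sq ?_ hB₁0
    rw [hB₁, mul_pow 11, Real.sq_sqrt (by positivity)]
    calc ((pulls o T γ : ℝ) * (u γd - u γ)) ^ 2
        = (pulls o T γ : ℝ) * ((pulls o T γ : ℝ) * (u γd - u γ) ^ 2) := by ring
      _ ≤ (T : ℝ) * (108 * Real.log T) := by gcongr
      _ ≤ 11 ^ 2 * (T * Real.log T) := by
        have : (0 : ℝ) ≤ T * Real.log T := by positivity
        linarith
  have far : ∀ γ, 2 ≤ (symmDiff γ γd).card → (pulls o T γ : ℝ) * (u γd - u γ) ≤ B₂ := by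
    intro γ hγ
    have h1 := pulls_mul_gap_sq_le hz hc hT hu1 hdom hgap le_rfl γ
    have h2 : lam / k ≤ u γd - u γ := by
      refine le_trans ?_ (hgap' γ)
      have : (2 : ℝ) ≤ (symmDiff γ γd).card := by exact_mod_cast hγ
      unfold hammingD
      rw [← sub_div, mul_div_assoc']
      gcongr
      nlinarith
    have h0 : (0 : ℝ) ≤ pulls o T γ := by positivity
    rw [hB₂, le_div_iff₀ hlam]
    rw [div_le_iff₀ (by linarith)] at h2
    have hd : 0 ≤ u γd - u γ := by linarith [hdom γ]
    calc (pulls o T γ : ℝ) * (u γd - u γ) * lam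
        ≤ (pulls o T γ : ℝ) * (u γd - u γ) * ((u γd - u γ) * k) := by gcongr
      _ = ((pulls o T γ : ℝ) * (u γd - u γ) ^ 2) * k := by ring
      _ ≤ _ := by gcongr
  have hmaps : ∀ γ ∈ A T, (symmDiff γ γd).card ∈ Finset.range (k + 1) := by
    intro γ _
    have := Finset.card_le_univ (symmDiff γ γd)
    simp only [Fintype.card_fin] at this
    exact Finset.mem_range.2 (by omega)
  have shell : ∀ h ∈ Finset.range (k + 1),
      ∑ γ ∈ A T with (symmDiff γ γd).card = h, (pulls o T γ : ℝ) * (u γd - u γ) ≤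
        (if h < 2 then k * B₁ else 0) + Q * B₂ := by
    intro h _
    split_ifs with hh
    · have h1 := Finset.sum_le_card_nsmul ((A T).filter fun γ => (symmDiff γ γd).card = h)
        (fun γ => (pulls o T γ : ℝ) * (u γd - u γ)) B₁ (fun γ _ => near γ)
      rw [nsmul_eq_mul] at h1
      have h2 : (((A T).filter fun γ => (symmDiff γ γd).card = h).card : ℝ) ≤ k := by
        exact_mod_cast card_shell_le γd (A T) hk hh
      have h3 := mul_le_mul_of_nonneg_right h2 hB₁0
      have h4 : 0 ≤ Q * B₂ := by positivity
      linarith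
    · have h1 := Finset.sum_le_card_nsmul ((A T).filter fun γ => (symmDiff γ γd).card = h)
        (fun γ => (pulls o T γ : ℝ) * (u γd - u γ)) B₂
        (fun γ hγ => far γ (by rw [(Finset.mem_filter.1 hγ).2]; omega))
      rw [nsmul_eq_mul] at h1
      have h2 := card_active_shell_le hz hc hk hlam hT hu1 hdom hu2 hgap hgap' (by omega : 1 ≤ h)
      have h3 := mul_le_mul_of_nonneg_right h2 hB₂0
      linarith
  rw [sum_order_eq_sum_pulls hz (fun γ => u γd - u γ), ← Finset.sum_fiberwise_of_maps_to hmaps]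
  refine (Finset.sum_le_sum shell).trans ?_
  rw [Finset.sum_add_distrib, Finset.sum_const, Finset.card_range, nsmul_eq_mul,
    ← Finset.sum_filter, Finset.sum_const, nsmul_eq_mul]
  have hc2 : (((Finset.range (k + 1)).filter (· < 2)).card : ℝ) ≤ 2 := by
    have : (Finset.range (k + 1)).filter (· < 2) ⊆ Finset.range 2 := by
      intro x hx
      exact Finset.mem_range.2 (Finset.mem_filter.1 hx).2
    exact_mod_cast (Finset.card_le_card this).trans (by simp)
  have e1 : (((Finset.range (k + 1)).filter (· < 2)).card : ℝ) * (k * B₁) ≤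
      22 * (k : ℝ) * Real.sqrt (T * Real.log T) := by
    calc _ ≤ 2 * (k * B₁) := by gcongr
      _ = _ := by rw [hB₁]; ring
  have e2 : ((k + 1 : ℕ) : ℝ) * (Q * B₂) ≤
      10800 / lam * (k : ℝ) ^ 2 * Real.log T * (2 : ℝ) ^ (3 * (k : ℝ) / 4) := by
    push_cast
    calc ((k : ℝ) + 1) * (Q * B₂) ≤ (2 * k) * (Q * B₂) := by gcongr; linarith
      _ = _ := by rw [hQ, hB₂]; field_simp; ring
  linarith

end Path

end DataMarkets

namespace DataMarkets

/-! ### Concentration of the empirical means -/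

namespace DataMarket

variable {n k : ℕ} (M : DataMarket n k) {α : ℝ}

lemma measurable_effUtility (α : ℝ) (i : Fin n) (γ : Order k) :
    Measurable fun x : Outcome n k => M.effUtility α x i γ := by
  unfold effUtility gain
  fun_prop

lemma measurable_utility (α : ℝ) (S : Profile n k) (i : Fin n) :
    Measurable fun x : Outcome n k => M.utility α x S i := by
  unfold utility gain transactionCost
  fun_prop

/-- Keeping the deterministic cost in the endpoints gives an interval of length 2, hence variance
proxy 1. -/
lemma effUtility_mem (hα0 : 0 ≤ α) (hα1 : α ≤ 1) (i : Fin n) (γ : Order k) :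
    ∀ᵐ x ∂M.law, M.effUtility α x i γ ∈ Set.Icc (-1 - M.cost γ) (1 - M.cost γ) := by
  filter_upwards [M.perf_mem, M.ext_sum_mem] with x h1 h2
  have h3 := h1 i γ
  have h4 := h2 i γ
  simp only [Set.mem_Icc] at h3 h4 ⊢
  unfold effUtility gain
  constructor <;> nlinarith [h4.1, h4.2, h3.1, h3.2]

lemma integrable_effUtility (hα0 : 0 ≤ α) (hα1 : α ≤ 1) (i : Fin n) (γ : Order k) :
    Integrable (fun x => M.effUtility α x i γ) M.law :=
  have := M.law_prob
  Integrable.of_mem_Icc _ _ (M.measurable_effUtility α i γ).aemeasurable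
    (M.effUtility_mem hα0 hα1 i γ)

lemma expEffUtility_mem (hα0 : 0 ≤ α) (hα1 : α ≤ 1) (i : Fin n) (γ : Order k) :
    M.expEffUtility α i γ ∈ Set.Icc (-2 : ℝ) 1 := by
  have := M.law_prob
  have hi := M.integrable_effUtility hα0 hα1 i γ
  have hc := M.cost_mem γ
  simp only [Set.mem_Icc] at hc
  constructor
  · have := integral_mono_ae (integrable_const (-2 : ℝ)) hi (by
      filter_upwards [M.effUtility_mem hα0 hα1 i γ] with x hx
      linarith [hx.1])
    simpa [expEffUtility] using this
  · have := integral_mono_ae hi (integrable_const (1 : ℝ)) (by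
      filter_upwards [M.effUtility_mem hα0 hα1 i γ] with x hx
      linarith [hx.2])
    simpa [expEffUtility] using this

lemma lintegral_exp_effUtility_le (hα0 : 0 ≤ α) (hα1 : α ≤ 1) (i : Fin n) (γ : Order k) (θ : ℝ) :
    ∫⁻ x, ENNReal.ofReal (Real.exp
      (θ * (M.effUtility α x i γ - M.expEffUtility α i γ) - θ ^ 2 / 2)) ∂M.law ≤ 1 := by
  have := M.law_prob
  have hsub := hasSubgaussianMGF_of_mem_Icc (M.measurable_effUtility α i γ).aemeasurable
    (M.effUtility_mem hα0 hα1 i γ)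
  have hc : ((‖(1 - M.cost γ) - (-1 - M.cost γ)‖₊ / 2) ^ 2 : NNReal) = 1 := by
    rw [show (1 - M.cost γ) - (-1 - M.cost γ) = 2 by ring]
    simp
  rw [hc] at hsub
  have h1 := hsub.mgf_le θ
  have h2 := hsub.integrable_exp_mul θ
  simp only [mgf, NNReal.coe_one, one_mul] at h1
  change ∫ x, Real.exp (θ * (M.effUtility α x i γ - M.expEffUtility α i γ)) ∂M.law ≤ _ at h1
  change Integrable (fun x => Real.exp (θ * (M.effUtility α x i γ - M.expEffUtility α i γ))) M.law
    at h2
  have e : ∀ x, Real.exp (θ * (M.effUtility α x i γ - M.expEffUtility α i γ) - θ ^ 2 / 2) =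
      Real.exp (θ * (M.effUtility α x i γ - M.expEffUtility α i γ)) * Real.exp (-(θ ^ 2 / 2)) := by
    intro x
    rw [← Real.exp_add]; rfl
  simp_rw [e]
  rw [← ofReal_integral_eq_lintegral_ofReal (h2.mul_const _)
    (Filter.Eventually.of_forall fun x => by positivity), integral_mul_const]
  rw [ENNReal.ofReal_le_one]
  calc _ ≤ Real.exp (θ ^ 2 / 2) * Real.exp (-(θ ^ 2 / 2)) := by
        gcongr
    _ = 1 := by rw [← Real.exp_add]; simp

end DataMarket

/-- Sum of the deviations of the observed rewards of `γ` from `v`. -/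
def deviation {k : ℕ} (r : ℕ → Order k → ℝ) (o : ℕ → Order k) (v : ℝ) (t : ℕ) (γ : Order k) : ℝ :=
  ∑ s ∈ (Finset.Icc 1 t).filter (fun s => o s = γ), (r s γ - v)

lemma deviation_succ {k : ℕ} (r : ℕ → Order k → ℝ) (o : ℕ → Order k) (v : ℝ) (t : ℕ)
    (γ : Order k) : deviation r o v (t + 1) γ =
      deviation r o v t γ + if o (t + 1) = γ then r (t + 1) γ - v else 0 := by
  unfold deviation
  rw [← Finset.insert_Icc_right_eq_Icc_add_one (by omega : 1 ≤ t + 1), Finset.filter_insert]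
  split_ifs with h
  · rw [Finset.sum_insert (by simp), add_comm]
  · simp

lemma deviation_eq {k : ℕ} (r : ℕ → Order k → ℝ) (o : ℕ → Order k) (v : ℝ) (t : ℕ)
    (γ : Order k) (h : pulls o t γ ≠ 0) :
    deviation r o v t γ = pulls o t γ * (empMean r o t γ - v) := by
  have h' : (pulls o t γ : ℝ) ≠ 0 := by exact_mod_cast h
  unfold deviation empMean
  rw [Finset.sum_sub_distrib, Finset.sum_const, nsmul_eq_mul, mul_sub, mul_div_cancel₀ _ h']
  rfl

lemma prod_exp_eq {k : ℕ} (r : ℕ → Order k → ℝ) (o : ℕ → Order k) (v θ : ℝ) (t : ℕ)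
    (γ : Order k) :
    (∏ s ∈ Finset.range t, if o (s + 1) = γ then
      ENNReal.ofReal (Real.exp (θ * (r (s + 1) γ - v) - θ ^ 2 / 2)) else 1) =
    ENNReal.ofReal (Real.exp (θ * deviation r o v t γ - θ ^ 2 / 2 * pulls o t γ)) := by
  induction t with
  | zero => simp [deviation, pulls]
  | succ t ih =>
    rw [Finset.prod_range_succ, ih, deviation_succ, pulls_succ]
    split_ifs with h
    · rw [← ENNReal.ofReal_mul (Real.exp_nonneg _), ← Real.exp_add]
      congr 2
      push_cast
      ring
    · simp

/-! ### Failure probability of the confidence bounds -/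

namespace ZoomingPlay

variable {n k : ℕ} {M : DataMarket n k} {α lam : ℝ} {T : ℕ} {Ω : Type*} {mΩ : MeasurableSpace Ω}
  {μ : Measure Ω} (Z : ZoomingPlay M α lam T μ)

lemma measurable_X {t : ℕ} (ht : t < T) : Measurable (Z.X (t + 1)) :=
  (Z.X_meas t ht).mono (Z.ℱ.le _) le_rfl

/-- Supermartingale step: whether `γ` is placed is decided by the past, and the new factor is
independent of the past with mean at most 1. On the rounds that place another order the product is
unchanged. -/
lemma lintegral_prod_le [IsProbabilityMeasure μ] (i : Fin n) (γ : Order k)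
    {g : Outcome n k → ENNReal} (hg : Measurable g) (hg1 : ∫⁻ x, g x ∂M.law ≤ 1) {t : ℕ}
    (ht : t ≤ T) :
    Measurable[Z.ℱ t] (fun ω => ∏ s ∈ Finset.range t,
      if Z.S (s + 1) ω i = γ then g (Z.X (s + 1) ω) else 1) ∧
    ∫⁻ ω, ∏ s ∈ Finset.range t, (if Z.S (s + 1) ω i = γ then g (Z.X (s + 1) ω) else 1) ∂μ ≤ 1 := by
  induction t with
  | zero => simp
  | succ t ih =>
    obtain ⟨hm, hle⟩ := ih (by omega)
    have htT : t < T := by omega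
    set W : Ω → ENNReal := fun ω => ∏ s ∈ Finset.range t,
      if Z.S (s + 1) ω i = γ then g (Z.X (s + 1) ω) else 1 with hW
    set D : Set Ω := {ω | Z.S (t + 1) ω i = γ} with hD
    have hDm : MeasurableSet[Z.ℱ t] D := Z.S_meas t htT i γ
    have hgm : Measurable[MeasurableSpace.comap (Z.X (t + 1)) inferInstance]
        (fun ω => g (Z.X (t + 1) ω)) := hg.comp (comap_measurable _)
    constructor
    · simp_rw [Finset.prod_range_succ]
      have h1 : Measurable[Z.ℱ (t + 1)] W := hm.mono (Z.ℱ.mono (by omega)) le_rfl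
      have h2 : Measurable[Z.ℱ (t + 1)]
          (fun ω => if Z.S (t + 1) ω i = γ then g (Z.X (t + 1) ω) else 1) :=
        Measurable.ite (m := Z.ℱ (t + 1)) (Z.ℱ.mono (by omega : t ≤ t + 1) _ hDm)
          (hg.comp (Z.X_meas t htT)) measurable_const
      exact h1.mul h2
    · have hX : ∫⁻ ω, g (Z.X (t + 1) ω) ∂μ ≤ 1 := by
        rw [← lintegral_map hg (Z.measurable_X htT), Z.X_law t htT]
        exact hg1
      have hWD : Measurable[Z.ℱ t] (D.indicator W) := hm.indicator hDm
      have hWm : Measurable W := hm.mono (Z.ℱ.le _) le_rfl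
      have hDm' : MeasurableSet D := Z.ℱ.le t _ hDm
      have e : ∀ ω, ∏ s ∈ Finset.range (t + 1),
          (if Z.S (s + 1) ω i = γ then g (Z.X (s + 1) ω) else 1) =
          D.indicator W ω * g (Z.X (t + 1) ω) + Dᶜ.indicator W ω := by
        intro ω
        rw [Finset.prod_range_succ]
        by_cases h : ω ∈ D
        · have h' : Z.S (t + 1) ω i = γ := h
          simp [h, h', hW]
        · have h' : ¬ Z.S (t + 1) ω i = γ := h
          simp [h, h', hW]
      simp_rw [e]
      rw [lintegral_add_right _ (hWm.indicator hDm'.compl),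
        lintegral_mul_eq_lintegral_mul_lintegral_of_independent_measurableSpace (Z.ℱ.le t)
          (Z.measurable_X htT).comap_le (Z.X_indep t htT).symm hWD hgm]
      calc _ ≤ (∫⁻ ω, D.indicator W ω ∂μ) * 1 + ∫⁻ ω, Dᶜ.indicator W ω ∂μ := by gcongr
        _ = ∫⁻ ω, W ω ∂μ := by
          rw [mul_one, lintegral_indicator hDm', lintegral_indicator hDm'.compl,
            lintegral_add_compl _ hDm']
        _ ≤ 1 := hle

/-- Rewards of buyer `i` along a sample path. -/
def reward (ω : Ω) (i : Fin n) (t : ℕ) (γ : Order k) : ℝ := M.effUtility α (Z.X t ω) i γ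

/-- Markov's inequality for the exponential supermartingale. Fixing the count `m` allows `θ` to be
tuned to it; the sign of `θ` selects the tail. -/
lemma measureReal_deviation_le [IsProbabilityMeasure μ] (hα0 : 0 ≤ α) (hα1 : α ≤ 1) (i : Fin n)
    (γ : Order k) {t : ℕ} (ht : t ≤ T) (m : ℕ) (θ : ℝ) :
    μ.real {ω | pulls (fun t => Z.S t ω i) t γ = m ∧ m * θ ^ 2 ≤
      θ * deviation (Z.reward ω i) (fun t => Z.S t ω i) (M.expEffUtility α i γ) t γ} ≤
    Real.exp (-(m * θ ^ 2 / 2)) := by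
  have hg : Measurable fun x : Outcome n k => ENNReal.ofReal (Real.exp
      (θ * (M.effUtility α x i γ - M.expEffUtility α i γ) - θ ^ 2 / 2)) := by
    have := M.measurable_effUtility α i γ
    fun_prop
  obtain ⟨hm, hle⟩ := Z.lintegral_prod_le i γ hg (M.lintegral_exp_effUtility_le hα0 hα1 i γ θ) ht
  have hm' := hm.mono (Z.ℱ.le _) le_rfl
  have hmk := mul_meas_ge_le_lintegral₀ hm'.aemeasurable (μ := μ)
    (ENNReal.ofReal (Real.exp (m * θ ^ 2 / 2)))
  have hsub : {ω | pulls (fun t => Z.S t ω i) t γ = m ∧ m * θ ^ 2 ≤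
      θ * deviation (Z.reward ω i) (fun t => Z.S t ω i) (M.expEffUtility α i γ) t γ} ⊆
      {ω | ENNReal.ofReal (Real.exp (m * θ ^ 2 / 2)) ≤ ∏ s ∈ Finset.range t,
        if Z.S (s + 1) ω i = γ then ENNReal.ofReal (Real.exp (θ * (M.effUtility α (Z.X (s + 1) ω) i γ
          - M.expEffUtility α i γ) - θ ^ 2 / 2)) else 1} := by
    rintro ω ⟨h1, h2⟩
    rw [Set.mem_ofPred_eq]
    have e := prod_exp_eq (Z.reward ω i) (fun t => Z.S t ω i) (M.expEffUtility α i γ) θ t γ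
    unfold reward at e h2
    rw [e, h1]
    apply ENNReal.ofReal_le_ofReal
    apply Real.exp_le_exp.2
    linarith
  have h3 := (mul_le_mul_right (measure_mono hsub)
    (ENNReal.ofReal (Real.exp (m * θ ^ 2 / 2)))).trans (hmk.trans hle)
  have h4 := ENNReal.toReal_mono ENNReal.one_ne_top h3
  rw [ENNReal.toReal_mul, ENNReal.toReal_ofReal (Real.exp_nonneg _), ENNReal.toReal_one] at h4
  rw [Real.exp_neg, ← one_div, le_div_iff₀ (Real.exp_pos _), mul_comm]
  exact h4

/-- The sample paths on which some confidence bound of buyer `i` fails. -/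
def badEvent (i : Fin n) : Set Ω :=
  {ω | ¬ Clean T (Z.reward ω i) (fun t => Z.S t ω i) (M.expEffUtility α i)}

/-- The left side is `T^(-6m/(m+1))`, which is `T⁻³` at `m = 1` and at most `T⁻⁴` afterwards.
Isolating `m = 1` keeps the sum over `m ≤ T` of order `T⁻³`. -/
lemma exp_tail_le (hT : 2 ≤ T) {m : ℕ} (hm : 1 ≤ m) :
    Real.exp (-(m * Real.sqrt (12 * Real.log T / ((m : ℝ) + 1)) ^ 2 / 2)) ≤
      (if m = 1 then ((T : ℝ) ^ 3)⁻¹ else 0) + ((T : ℝ) ^ 4)⁻¹ := by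
  have hL := log_ge_of_two_le hT
  have hT0 : (0 : ℝ) < T := by positivity
  have hpow : ∀ j : ℕ, ((T : ℝ) ^ j)⁻¹ = Real.exp (-(j * Real.log T)) := by
    intro j
    rw [Real.exp_neg, ← Real.log_pow, Real.exp_log (by positivity)]
  rw [Real.sq_sqrt (by positivity)]
  have hexp : -((m : ℝ) * (12 * Real.log T / ((m : ℝ) + 1)) / 2) =
      -(6 * m / (m + 1) * Real.log T) := by field_simp; ring
  rw [hexp]
  split_ifs with h
  · subst h
    have h1 : (0 : ℝ) ≤ ((T : ℝ) ^ 4)⁻¹ := by positivity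
    rw [hpow 3]
    have : Real.exp (-(6 * ((1 : ℕ) : ℝ) / (((1 : ℕ) : ℝ) + 1) * Real.log T)) =
      Real.exp (-(((3 : ℕ) : ℝ) * Real.log T)) := by norm_num
    linarith
  · rw [zero_add, hpow 4]
    apply Real.exp_le_exp.2
    have hm2 : (2 : ℝ) ≤ m := by exact_mod_cast (by omega : 2 ≤ m)
    have : ((4 : ℕ) : ℝ) ≤ 6 * m / (m + 1) := by
      rw [le_div_iff₀ (by positivity)]
      push_cast
      linarith
    nlinarith

lemma measureReal_badEvent_le [IsProbabilityMeasure μ] (hα0 : 0 ≤ α) (hα1 : α ≤ 1) (hT : 2 ≤ T)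
    (i : Fin n) : μ.real (Z.badEvent i) ≤ 4 * (2 : ℝ) ^ k / (T : ℝ) ^ 2 := by
  set E : ℕ → Order k → ℕ → ℝ → Set Ω := fun t γ m θ =>
    {ω | pulls (fun t => Z.S t ω i) t γ = m ∧ m * θ ^ 2 ≤
      θ * deviation (Z.reward ω i) (fun t => Z.S t ω i) (M.expEffUtility α i γ) t γ} with hE
  set ε : ℕ → ℝ := fun m => Real.sqrt (12 * Real.log T / ((m : ℝ) + 1)) with hε
  have hT0 : (0 : ℝ) < T := by positivity
  have hsub : Z.badEvent i ⊆ ⋃ t ∈ Finset.range T, ⋃ γ ∈ (Finset.univ : Finset (Order k)),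
      ⋃ m ∈ Finset.Icc 1 T, (E t γ m (ε m) ∪ E t γ m (-ε m)) := by
    intro ω hω
    simp only [badEvent, Clean, Set.mem_ofPred_eq, not_forall, not_le] at hω
    obtain ⟨t, ht, γ, h⟩ := hω
    set o : ℕ → Order k := fun t => Z.S t ω i
    -- With no observation the default mean 0 is within 2 of the true mean, and the radius is at
    -- least 2, so the bound cannot fail.
    have hp : pulls o t γ ≠ 0 := by
      intro hp
      have h1 : 2 ≤ confRadius T o t γ := two_le_confRadius hT (by omega)
      have h2 : empMean (Z.reward ω i) o t γ = 0 := by simp [empMean, hp]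
      have h3 := M.expEffUtility_mem hα0 hα1 i γ
      have h4 : |empMean (Z.reward ω i) o t γ - M.expEffUtility α i γ| ≤ 2 := by
        rw [h2, abs_le]
        constructor <;> linarith [h3.1, h3.2]
      linarith
    have hmem : pulls o t γ ∈ Finset.Icc 1 T :=
      Finset.mem_Icc.2 ⟨by omega, (pulls_le o t γ).trans ht.le⟩
    simp only [Set.mem_iUnion]
    refine ⟨t, Finset.mem_range.2 ht, γ, Finset.mem_univ _, pulls o t γ, hmem, ?_⟩
    have hd := deviation_eq (Z.reward ω i) o (M.expEffUtility α i γ) t γ hp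
    have hε' : confRadius T o t γ = ε (pulls o t γ) := rfl
    have hε0 : 0 ≤ ε (pulls o t γ) := Real.sqrt_nonneg _
    have hp0 : (0 : ℝ) ≤ pulls o t γ := by positivity
    rw [hε'] at h
    rcases lt_abs.1 h with h | h
    · left
      refine ⟨rfl, ?_⟩
      rw [hd]
      nlinarith [mul_nonneg (mul_nonneg hp0 hε0) (sub_nonneg.2 h.le)]
    · right
      refine ⟨rfl, ?_⟩
      rw [hd]
      nlinarith [mul_nonneg (mul_nonneg hp0 hε0) (sub_nonneg.2 h.le)]
  have hEle : ∀ t ∈ Finset.range T, ∀ γ, ∀ m ∈ Finset.Icc 1 T,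
      μ.real (E t γ m (ε m) ∪ E t γ m (-ε m)) ≤
        2 * ((if m = 1 then ((T : ℝ) ^ 3)⁻¹ else 0) + ((T : ℝ) ^ 4)⁻¹) := by
    intro t ht γ m hm
    have ht' := (Finset.mem_range.1 ht).le
    have h1 := Z.measureReal_deviation_le hα0 hα1 i γ ht' m (ε m)
    have h2 := Z.measureReal_deviation_le hα0 hα1 i γ ht' m (-ε m)
    rw [neg_sq] at h2
    have h3 := exp_tail_le hT (Finset.mem_Icc.1 hm).1
    have h4 := measureReal_union_le (μ := μ) (E t γ m (ε m)) (E t γ m (-ε m))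
    have h2' : μ.real (E t γ m (-ε m)) ≤ Real.exp (-(m * ε m ^ 2 / 2)) := by
      simpa only [hE, neg_sq] using h2
    linarith
  have hsum : ∑ m ∈ Finset.Icc 1 T,
      2 * ((if m = 1 then ((T : ℝ) ^ 3)⁻¹ else 0) + ((T : ℝ) ^ 4)⁻¹) = 4 * ((T : ℝ) ^ 3)⁻¹ := by
    rw [← Finset.mul_sum, Finset.sum_add_distrib, Finset.sum_ite_eq', if_pos (by simp; omega)]
    simp
    field_simp
    norm_num
  calc μ.real (Z.badEvent i)
      ≤ μ.real (⋃ t ∈ Finset.range T, ⋃ γ ∈ (Finset.univ : Finset (Order k)),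
          ⋃ m ∈ Finset.Icc 1 T, (E t γ m (ε m) ∪ E t γ m (-ε m))) :=
        measureReal_mono hsub (measure_ne_top _ _)
    _ ≤ ∑ t ∈ Finset.range T, ∑ γ : Order k, ∑ m ∈ Finset.Icc 1 T,
          μ.real (E t γ m (ε m) ∪ E t γ m (-ε m)) :=
        (measureReal_biUnion_finset_le _ _).trans (Finset.sum_le_sum fun t _ =>
          (measureReal_biUnion_finset_le _ _).trans (Finset.sum_le_sum fun γ _ =>
            measureReal_biUnion_finset_le _ _))
    _ ≤ ∑ t ∈ Finset.range T, ∑ γ : Order k, 4 * ((T : ℝ) ^ 3)⁻¹ := by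
        refine Finset.sum_le_sum fun t ht => Finset.sum_le_sum fun γ _ => ?_
        rw [← hsum]
        exact Finset.sum_le_sum fun m hm => hEle t ht γ m hm
    _ = 4 * (2 : ℝ) ^ k / (T : ℝ) ^ 2 := by
        simp
        field_simp

end ZoomingPlay

end DataMarkets

namespace DataMarkets

/-! ### Welfare in terms of effective utilities -/

namespace DataMarket

variable {n k : ℕ} (M : DataMarket n k) {α : ℝ}

lemma integrable_perf (i : Fin n) (γ : Order k) :
    Integrable (fun x : Outcome n k => x.1 i γ) M.law :=
  have := M.law_prob
  Integrable.of_mem_Icc 0 1 (by fun_prop) (M.perf_mem.mono fun _ h => h i γ)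

lemma integrable_ext_sum (i : Fin n) (γ : Order k) :
    Integrable (fun x : Outcome n k => ∑ j ∈ Finset.univ.erase i, x.2 j i γ) M.law :=
  have := M.law_prob
  Integrable.of_mem_Icc 0 1 (by fun_prop) (M.ext_sum_mem.mono fun _ h => h i γ)

lemma integrable_ext_suffered (i : Fin n) (S : Profile n k) :
    Integrable (fun x : Outcome n k => ∑ j ∈ Finset.univ.erase i, x.2 i j (S j)) M.law :=
  integrable_finsetSum _ fun j hj => M.ext_integrable i j (S j) (Finset.ne_of_mem_erase hj).symm

lemma integrable_utility (α : ℝ) (S : Profile n k) (i : Fin n) :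
    Integrable (fun x => M.utility α x S i) M.law := by
  have := M.law_prob
  unfold utility gain transactionCost
  exact (((M.integrable_perf i (S i)).sub (integrable_const _)).sub
    (M.integrable_ext_suffered i S)).sub
    (((M.integrable_ext_sum i (S i)).sub (M.integrable_ext_suffered i S)).const_mul α)

/-- The transfers cancel: the total utility is the total effective utility minus the part of the
externalities that is not charged. -/
lemma sum_utility_eq (α : ℝ) (x : Outcome n k) (S : Profile n k) :
    ∑ i, M.utility α x S i = ∑ i, (M.effUtility α x i (S i) -
      (1 - α) * ∑ j ∈ Finset.univ.erase i, x.2 j i (S i)) := by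
  have swap : ∑ i, ∑ j ∈ Finset.univ.erase i, x.2 i j (S j) =
      ∑ i, ∑ j ∈ Finset.univ.erase i, x.2 j i (S i) := by
    refine Finset.sum_comm' fun i j => ?_
    simp [eq_comm]
  have e : ∀ i, M.utility α x S i = (M.effUtility α x i (S i) -
      (1 - α) * ∑ j ∈ Finset.univ.erase i, x.2 j i (S i)) +
      (1 - α) * (∑ j ∈ Finset.univ.erase i, x.2 j i (S i) -
        ∑ j ∈ Finset.univ.erase i, x.2 i j (S j)) := by
    intro i
    unfold utility effUtility transactionCost
    ring
  simp_rw [e]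
  rw [Finset.sum_add_distrib, ← Finset.mul_sum Finset.univ (fun i => _ - _) (1 - α),
    Finset.sum_sub_distrib (fun i => ∑ j ∈ Finset.univ.erase i, x.2 j i (S i)), swap]
  simp

lemma welfare_eq (hα0 : 0 ≤ α) (hα1 : α ≤ 1) (S : Profile n k) :
    M.welfare α S = ∑ i, (M.expEffUtility α i (S i) -
      (1 - α) * ∫ x, ∑ j ∈ Finset.univ.erase i, x.2 j i (S i) ∂M.law) := by
  unfold welfare expUtility
  rw [← integral_finsetSum _ fun i _ => M.integrable_utility α S i]
  simp_rw [M.sum_utility_eq]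
  have hint : ∀ i ∈ (Finset.univ : Finset (Fin n)), Integrable (fun x => M.effUtility α x i (S i) -
      (1 - α) * ∑ j ∈ Finset.univ.erase i, x.2 j i (S i)) M.law := fun i _ =>
    (M.integrable_effUtility hα0 hα1 i (S i)).sub ((M.integrable_ext_sum i (S i)).const_mul _)
  rw [integral_finsetSum _ hint]
  refine Finset.sum_congr rfl fun i _ => ?_
  rw [integral_sub (M.integrable_effUtility hα0 hα1 i (S i))
    ((M.integrable_ext_sum i (S i)).const_mul _), integral_const_mul]
  rfl

lemma integral_ext_sum_mem (i : Fin n) (γ : Order k) :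
    ∫ x, ∑ j ∈ Finset.univ.erase i, x.2 j i γ ∂M.law ∈ Set.Icc (0 : ℝ) 1 := by
  have := M.law_prob
  constructor
  · exact integral_nonneg_of_ae (M.ext_sum_mem.mono fun x h => (h i γ).1)
  · have := integral_mono_ae (M.integrable_ext_sum i γ) (integrable_const (1 : ℝ))
      (M.ext_sum_mem.mono fun x h => (h i γ).2)
    simpa using this

lemma welfare_sub_le (hα0 : 0 ≤ α) (hα1 : α ≤ 1) (S S' : Profile n k) :
    M.welfare α S' - M.welfare α S ≤
      ∑ i, (M.expEffUtility α i (S' i) - M.expEffUtility α i (S i)) + n * (1 - α) := by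
  rw [M.welfare_eq hα0 hα1, M.welfare_eq hα0 hα1, ← Finset.sum_sub_distrib]
  have : (n : ℝ) * (1 - α) = ∑ _i : Fin n, (1 - α) := by
    rw [Finset.sum_const, Finset.card_univ, Fintype.card_fin, nsmul_eq_mul]
  rw [this, ← Finset.sum_add_distrib]
  refine Finset.sum_le_sum fun i _ => ?_
  have h1 := M.integral_ext_sum_mem i (S i)
  have h2 := M.integral_ext_sum_mem i (S' i)
  nlinarith [h1.1, h1.2, h2.1, h2.2]

end DataMarket

/-! ### Expected regret -/

namespace ZoomingPlay

variable {n k : ℕ} {M : DataMarket n k} {α lam : ℝ} {T : ℕ} {Ω : Type*} {mΩ : MeasurableSpace Ω}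
  {μ : Measure Ω} (Z : ZoomingPlay M α lam T μ)

lemma measurableSet_profile {t : ℕ} (ht : t < T) (S : Profile n k) :
    MeasurableSet[Z.ℱ t] {ω | Z.S (t + 1) ω = S} := by
  have : {ω | Z.S (t + 1) ω = S} = ⋂ i, {ω | Z.S (t + 1) ω i = S i} := by
    ext ω; simp [funext_iff]
  rw [this]
  exact MeasurableSet.iInter fun i => Z.S_meas t ht i (S i)

/-- The profile is determined by the past, and conditionally on the past the outcome has its
unconditional mean. -/
lemma setIntegral_profile [IsProbabilityMeasure μ] {t : ℕ} (ht : t < T) (S : Profile n k)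
    {f : Outcome n k → ℝ} (hf : Measurable f) (hfi : Integrable f M.law) :
    Integrable (fun ω => f (Z.X (t + 1) ω)) μ ∧
    ∫ ω in {ω | Z.S (t + 1) ω = S}, f (Z.X (t + 1) ω) ∂μ =
      μ.real {ω | Z.S (t + 1) ω = S} * ∫ x, f x ∂M.law := by
  have hX := Z.measurable_X ht
  have hint : Integrable (fun ω => f (Z.X (t + 1) ω)) μ := by
    rw [← Z.X_law t ht] at hfi
    exact hfi.comp_measurable hX
  refine ⟨hint, ?_⟩
  have hm := Z.measurableSet_profile ht S
  have hfm : StronglyMeasurable[MeasurableSpace.comap (Z.X (t + 1)) inferInstance]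
      (fun ω => f (Z.X (t + 1) ω)) :=
    (hf.comp (comap_measurable _)).stronglyMeasurable
  have hce := condExp_indep_eq hX.comap_le (Z.ℱ.le t) hfm (Z.X_indep t ht)
  rw [← setIntegral_condExp (Z.ℱ.le t) hint hm,
    setIntegral_congr_ae (g := fun _ => ∫ ω, f (Z.X (t + 1) ω) ∂μ) (Z.ℱ.le t _ hm)
      (hce.mono fun ω h _ => h), setIntegral_const, smul_eq_mul, ← Z.X_law t ht,
    integral_map hX.aemeasurable hf.aestronglyMeasurable]

lemma sum_indicator_profile {t : ℕ} (f : Profile n k → Ω → ℝ) (ω : Ω) :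
    f (Z.S t ω) ω = ∑ S, {ω | Z.S t ω = S}.indicator (f S) ω := by
  rw [Finset.sum_eq_single (Z.S t ω)]
  · simp
  · intro S _ hS
    have h : ω ∉ {ω | Z.S t ω = S} := fun h => hS (Eq.symm h)
    exact Set.indicator_of_notMem h (f S)
  · simp

lemma integrable_profile [IsProbabilityMeasure μ] {t : ℕ} (ht : t < T) (g : Profile n k → ℝ) :
    Integrable (fun ω => g (Z.S (t + 1) ω)) μ := by
  have e := fun ω => Z.sum_indicator_profile (t := t + 1) (fun S _ => g S) ω
  simp_rw [e]
  exact integrable_finsetSum _ fun S _ =>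
    (integrable_const _).indicator (Z.ℱ.le t _ (Z.measurableSet_profile ht S))

/-- The outcome of a round is independent of the profile ordered in it. -/
lemma integral_profile_outcome [IsProbabilityMeasure μ] {t : ℕ} (ht : t < T)
    {f : Profile n k → Outcome n k → ℝ} (hf : ∀ S, Measurable (f S))
    (hfi : ∀ S, Integrable (f S) M.law) :
    Integrable (fun ω => f (Z.S (t + 1) ω) (Z.X (t + 1) ω)) μ ∧
    ∫ ω, f (Z.S (t + 1) ω) (Z.X (t + 1) ω) ∂μ =
      ∫ ω, (∫ x, f (Z.S (t + 1) ω) x ∂M.law) ∂μ := by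
  have hm : ∀ S, MeasurableSet {ω | Z.S (t + 1) ω = S} := fun S =>
    Z.ℱ.le t _ (Z.measurableSet_profile ht S)
  have h := fun S => Z.setIntegral_profile ht S (hf S) (hfi S)
  have e1 := fun ω => Z.sum_indicator_profile (t := t + 1) (fun S ω => f S (Z.X (t + 1) ω)) ω
  have e2 := fun ω => Z.sum_indicator_profile (t := t + 1) (fun S _ => ∫ x, f S x ∂M.law) ω
  have hint : ∀ S ∈ (Finset.univ : Finset (Profile n k)), Integrable
      ({ω | Z.S (t + 1) ω = S}.indicator fun ω => f S (Z.X (t + 1) ω)) μ :=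
    fun S _ => (h S).1.indicator (hm S)
  simp_rw [e1, e2]
  refine ⟨integrable_finsetSum _ hint, ?_⟩
  rw [integral_finsetSum _ hint, integral_finsetSum _ fun S _ =>
    (integrable_const _).indicator (hm S)]
  refine Finset.sum_congr rfl fun S _ => ?_
  rw [integral_indicator (hm S), integral_indicator (hm S), (h S).2, setIntegral_const, smul_eq_mul]

lemma welfareRegret_eq [IsProbabilityMeasure μ] (Sopt : Profile n k) :
    Z.welfareRegret Sopt =
      ∑ t ∈ Finset.range T, ∫ ω, (M.welfare α Sopt - M.welfare α (Z.S (t + 1) ω)) ∂μ := by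
  have key : ∀ t ∈ Finset.range T, ∀ i,
      Integrable (fun ω => M.utility α (Z.X (t + 1) ω) Sopt i -
        M.utility α (Z.X (t + 1) ω) (Z.S (t + 1) ω) i) μ ∧
      ∫ ω, (M.utility α (Z.X (t + 1) ω) Sopt i -
        M.utility α (Z.X (t + 1) ω) (Z.S (t + 1) ω) i) ∂μ =
      ∫ ω, (M.expUtility α Sopt i - M.expUtility α (Z.S (t + 1) ω) i) ∂μ := by
    intro t ht i
    have h := Z.integral_profile_outcome (Finset.mem_range.1 ht)
      (f := fun S x => M.utility α x Sopt i - M.utility α x S i)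
      (fun S => (M.measurable_utility α Sopt i).sub (M.measurable_utility α S i))
      (fun S => (M.integrable_utility α Sopt i).sub (M.integrable_utility α S i))
    refine ⟨h.1, h.2.trans ?_⟩
    congr 1
    funext ω
    exact integral_sub (M.integrable_utility α Sopt i) (M.integrable_utility α _ i)
  unfold welfareRegret
  have hIcc : Finset.Icc 1 T = (Finset.range T).image (· + 1) := by
    ext t
    simp only [Finset.mem_Icc, Finset.mem_image, Finset.mem_range]
    exact ⟨fun h => ⟨t - 1, by omega, by omega⟩, by rintro ⟨s, hs, rfl⟩; omega⟩
  simp_rw [hIcc, Finset.sum_image (fun a _ b _ (h : a + 1 = b + 1) => Nat.succ_injective h)]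
  have e1 : ∀ i, ∫ ω, ∑ t ∈ Finset.range T, (M.utility α (Z.X (t + 1) ω) Sopt i -
        M.utility α (Z.X (t + 1) ω) (Z.S (t + 1) ω) i) ∂μ = ∑ t ∈ Finset.range T,
      ∫ ω, (M.expUtility α Sopt i - M.expUtility α (Z.S (t + 1) ω) i) ∂μ := by
    intro i
    rw [integral_finsetSum _ fun t ht => (key t ht i).1]
    exact Finset.sum_congr rfl fun t ht => (key t ht i).2
  simp_rw [e1]
  rw [Finset.sum_comm]
  refine Finset.sum_congr rfl fun t ht => ?_
  rw [← integral_finsetSum _ fun i _ => Z.integrable_profile (Finset.mem_range.1 ht)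
    (fun S => M.expUtility α Sopt i - M.expUtility α S i)]
  simp_rw [DataMarket.welfare, Finset.sum_sub_distrib]

/-- Total gap of buyer `i` to the order `γd`. -/
noncomputable def totalGap (i : Fin n) (γd : Order k) (ω : Ω) : ℝ :=
  ∑ t ∈ Finset.Icc 1 T, (M.expEffUtility α i γd - M.expEffUtility α i (Z.S t ω i))

lemma integrable_totalGap [IsProbabilityMeasure μ] (i : Fin n) (γd : Order k) :
    Integrable (Z.totalGap i γd) μ := by
  refine integrable_finsetSum _ fun t ht => ?_
  rw [Finset.mem_Icc] at ht
  obtain ⟨s, rfl⟩ : ∃ s, t = s + 1 := ⟨t - 1, by omega⟩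
  exact Z.integrable_profile (by omega : s < T)
    (fun S => M.expEffUtility α i γd - M.expEffUtility α i (S i))

/-- Dominance lets each `γd i` replace `Sopt i`, which decouples the buyers; uncharged externalities
cost at most `1 - α` per buyer and round. -/
lemma welfareRegret_le [IsProbabilityMeasure μ] (hα0 : 0 ≤ α) (hα1 : α ≤ 1) (Sopt : Profile n k)
    {γd : Profile n k} (hdom : ∀ i, M.IsDominant α i (γd i)) :
    Z.welfareRegret Sopt ≤ ∑ i, ∫ ω, Z.totalGap i (γd i) ω ∂μ + n * ((1 - α) * T) := by
  have hgi : ∀ i, ∀ t ∈ Finset.Icc 1 T, Integrable (fun ω =>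
      M.expEffUtility α i (γd i) - M.expEffUtility α i (Z.S t ω i)) μ := by
    intro i t ht
    rw [Finset.mem_Icc] at ht
    obtain ⟨s, rfl⟩ : ∃ s, t = s + 1 := ⟨t - 1, by omega⟩
    exact Z.integrable_profile (by omega : s < T)
      (fun S => M.expEffUtility α i (γd i) - M.expEffUtility α i (S i))
  have hround : ∀ t ∈ Finset.range T,
      ∫ ω, (M.welfare α Sopt - M.welfare α (Z.S (t + 1) ω)) ∂μ ≤
      ∑ i, ∫ ω, (M.expEffUtility α i (γd i) - M.expEffUtility α i (Z.S (t + 1) ω i)) ∂μ +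
        n * (1 - α) := by
    intro t ht
    have htT := Finset.mem_range.1 ht
    have hmem : t + 1 ∈ Finset.Icc 1 T := Finset.mem_Icc.2 ⟨by omega, by omega⟩
    rw [← integral_finsetSum _ fun i _ => hgi i (t + 1) hmem]
    have hc : (n : ℝ) * (1 - α) = ∫ _ω : Ω, (n : ℝ) * (1 - α) ∂μ := by simp
    rw [hc, ← integral_add (integrable_finsetSum _ fun i _ => hgi i (t + 1) hmem)
      (integrable_const _)]
    refine integral_mono (Z.integrable_profile htT fun S => M.welfare α Sopt - M.welfare α S)
      ((integrable_finsetSum _ fun i _ => hgi i (t + 1) hmem).add (integrable_const _))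
      fun ω => ?_
    refine (M.welfare_sub_le hα0 hα1 (Z.S (t + 1) ω) Sopt).trans ?_
    gcongr with i _
    exact hdom i (Sopt i)
  rw [Z.welfareRegret_eq Sopt]
  refine (Finset.sum_le_sum hround).trans (le_of_eq ?_)
  rw [Finset.sum_add_distrib, Finset.sum_comm]
  congr 1
  · refine Finset.sum_congr rfl fun i _ => ?_
    unfold totalGap
    rw [integral_finsetSum _ (hgi i)]
    have hIcc : Finset.Icc 1 T = (Finset.range T).image (· + 1) := by
      ext t
      simp only [Finset.mem_Icc, Finset.mem_image, Finset.mem_range]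
      exact ⟨fun h => ⟨t - 1, by omega, by omega⟩, by rintro ⟨s, hs, rfl⟩; omega⟩
    rw [hIcc, Finset.sum_image (fun a _ b _ (h : a + 1 = b + 1) => Nat.succ_injective h)]
  · simp; ring

/-- Expected regret of one buyer with respect to her expected effective utility. -/
theorem integral_totalGap_le [IsProbabilityMeasure μ] (hα0 : 0 ≤ α) (hα1 : α ≤ 1)
    (hlam : 0 < lam) (hk : 1 ≤ k) (hT : 2 ≤ T) (i : Fin n) {γd : Order k}
    (hdom : M.IsDominant α i γd)
    (hclose : ∀ γ, M.expEffUtility α i γd - M.expEffUtility α i γ ∈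
      Set.Icc (lam * (hammingD γ γd - 1 / (k : ℝ))) (lam * hammingD γ γd)) :
    ∫ ω, Z.totalGap i γd ω ∂μ ≤
      22 * ((k : ℝ) ^ 2 * Real.sqrt (T * Real.log T)) + (16000 / lam + 9 * lam) *
        ((k : ℝ) ^ 3 * Real.log T ^ 2 * (2 : ℝ) ^ (3 * (k : ℝ) / 4)) := by
  have hL := log_ge_of_two_le hT
  have hk' : (1 : ℝ) ≤ k := by exact_mod_cast hk
  have hT0 : (0 : ℝ) < T := by positivity
  set P : ℝ := (2 : ℝ) ^ (3 * (k : ℝ) / 4) with hP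
  have hP0 : 0 < P := by positivity
  set L := Real.log T with hLdef
  set R : ℝ := (k : ℝ) ^ 3 * L ^ 2 * P with hR
  have hPR : P ≤ 2.2 * R := by
    have h1 : (1 : ℝ) ≤ (k : ℝ) ^ 3 := one_le_pow₀ hk'
    have h2 : (1 : ℝ) ≤ 2.2 * L ^ 2 := by nlinarith
    have h3 : (1 : ℝ) ≤ (k : ℝ) ^ 3 * (2.2 * L ^ 2) := one_le_mul_of_one_le_of_one_le h1 h2
    have := le_mul_of_one_le_left hP0.le h3
    rw [hR]
    linarith
  have hR0 : 0 ≤ R := by positivity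
  have hsq0 : 0 ≤ (k : ℝ) ^ 2 * Real.sqrt (T * L) := by positivity
  have htriv : ∀ ω, Z.totalGap i γd ω ≤ lam * T := by
    intro ω
    have h1 : ∀ t ∈ Finset.Icc 1 T,
        M.expEffUtility α i γd - M.expEffUtility α i (Z.S t ω i) ≤ lam := fun t _ =>
      (hclose _).2.trans (mul_le_of_le_one_right hlam.le (hammingD_le_one _ _))
    have h2 := Finset.sum_le_card_nsmul _ _ _ h1
    rw [nsmul_eq_mul, Nat.card_Icc, Nat.add_sub_cancel] at h2
    unfold totalGap
    linarith
  have hint := Z.integrable_totalGap i γd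
  -- For `T < P` the trivial bound `lam T` suffices. For `T ≥ P` the failure term is of order `lam
  -- 2^k / T ≤ lam P`, because `2^k ≤ P²`.
  rcases lt_or_ge (T : ℝ) P with hTP | hTP
  · have h1 := integral_mono hint (integrable_const (lam * T)) htriv
    simp only [integral_const, probReal_univ, one_smul] at h1
    have h2 : lam * T ≤ 9 * lam * R := by nlinarith
    have h3 : 0 ≤ 16000 / lam * R := by positivity
    linarith
  · set B : ℝ := 22 * (k : ℝ) * Real.sqrt (T * L) + 10800 / lam * (k : ℝ) ^ 2 * L * P with hB
    have hB0 : 0 ≤ B := by positivity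
    -- A measurable hull has the same measure, so measurability of the bad event itself is not
    -- needed.
    set E := toMeasurable μ (Z.badEvent i) with hE
    have hEm : MeasurableSet E := measurableSet_toMeasurable _ _
    have hbound : ∀ ω, Z.totalGap i γd ω ≤ B + E.indicator (fun _ => lam * T) ω := by
      intro ω
      by_cases hω : ω ∈ E
      · rw [Set.indicator_of_mem hω]
        linarith [htriv ω]
      · rw [Set.indicator_of_notMem hω, add_zero]
        have hclean : Clean T (Z.reward ω i) (fun t => Z.S t ω i) (M.expEffUtility α i) := by
          by_contra hcon
          exact hω (subset_toMeasurable _ _ hcon)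
        exact sum_gap_le_of_clean (Z.zooming ω i) hclean hk hlam hT
          (M.expEffUtility_mem hα0 hα1 i γd).2 hdom
          (fun γ => (M.expEffUtility_mem hα0 hα1 i γ).1) (fun γ => (hclose γ).2)
          (fun γ => (hclose γ).1)
    have h1 := integral_mono hint
      ((integrable_const B).add ((integrable_const (lam * T)).indicator hEm)) hbound
    simp only [Pi.add_apply] at h1
    rw [integral_add (integrable_const B) ((integrable_const (lam * T)).indicator hEm),
      integral_indicator hEm, setIntegral_const] at h1
    simp only [integral_const, probReal_univ, smul_eq_mul] at h1
    have h2 : μ.real E ≤ 4 * (2 : ℝ) ^ k / (T : ℝ) ^ 2 := by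
      have : μ.real E = μ.real (Z.badEvent i) := by
        simp only [Measure.real, hE, measure_toMeasurable]
      rw [this]
      exact Z.measureReal_badEvent_le hα0 hα1 hT i
    have hPP : (2 : ℝ) ^ k ≤ P * P := by
      rw [hP, ← Real.rpow_add (by norm_num), ← Real.rpow_natCast]
      apply Real.rpow_le_rpow_of_exponent_le (by norm_num)
      linarith
    have h3 : μ.real E * (lam * T) ≤ 9 * lam * R := by
      calc μ.real E * (lam * T) ≤ 4 * (2 : ℝ) ^ k / (T : ℝ) ^ 2 * (lam * T) := by gcongr
        _ = 4 * lam * ((2 : ℝ) ^ k / T) := by field_simp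
        _ ≤ 4 * lam * P := by
          gcongr
          rw [div_le_iff₀ hT0]
          exact hPP.trans (by gcongr)
        _ ≤ 4 * lam * (2.2 * R) := by gcongr
        _ ≤ 9 * lam * R := by nlinarith [mul_nonneg hlam.le hR0]
    have h4 : 22 * (k : ℝ) * Real.sqrt (T * L) ≤ 22 * ((k : ℝ) ^ 2 * Real.sqrt (T * L)) := by
      rw [mul_assoc]
      gcongr
      nlinarith
    have h5 : 10800 / lam * (k : ℝ) ^ 2 * L * P ≤ 16000 / lam * R := by
      have : (k : ℝ) ^ 2 * L ≤ 40 / 27 * ((k : ℝ) ^ 3 * L ^ 2) := by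
        have a1 : (1 : ℝ) ≤ k * (40 / 27 * L) :=
          one_le_mul_of_one_le_of_one_le hk' (by linarith)
        have := le_mul_of_one_le_right (by positivity : 0 ≤ (k : ℝ) ^ 2 * L) a1
        linarith
      calc 10800 / lam * (k : ℝ) ^ 2 * L * P = 10800 / lam * ((k : ℝ) ^ 2 * L) * P := by ring
        _ ≤ 10800 / lam * (40 / 27 * ((k : ℝ) ^ 3 * L ^ 2)) * P := by gcongr
        _ = 16000 / lam * R := by rw [hR]; ring
    linarith

end ZoomingPlay

/-! ### The transaction parameter and the final bound -/

lemma alphaStar_nonneg (k T : ℕ) : 0 ≤ alphaStar k T := le_max_left _ _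

lemma alphaStar_le_one (k T : ℕ) : alphaStar k T ≤ 1 := by
  have := Real.log_natCast_nonneg T
  refine max_le zero_le_one (sub_le_self _ (le_min ?_ ?_)) <;> positivity

lemma one_sub_alphaStar_mul_le (k T : ℕ) (hT : 2 ≤ T) :
    (1 - alphaStar k T) * T ≤ (k : ℝ) ^ 2 * Real.sqrt (T * Real.log T) := by
  have hT0 : (0 : ℝ) < T := by positivity
  have h : 1 - alphaStar k T ≤ (k : ℝ) ^ 2 * Real.sqrt (Real.log T) / Real.sqrt T := by
    have h1 : 1 - min ((k : ℝ) ^ 2 * Real.sqrt (Real.log T) / Real.sqrt T)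
      ((k : ℝ) ^ 3 * (2 : ℝ) ^ (3 * (k : ℝ) / 4) * Real.log T ^ 2 / (T : ℝ)) ≤ alphaStar k T :=
      le_max_right _ _
    have h2 := min_le_left ((k : ℝ) ^ 2 * Real.sqrt (Real.log T) / Real.sqrt T)
      ((k : ℝ) ^ 3 * (2 : ℝ) ^ (3 * (k : ℝ) / 4) * Real.log T ^ 2 / (T : ℝ))
    linarith
  calc (1 - alphaStar k T) * T
      ≤ (k : ℝ) ^ 2 * Real.sqrt (Real.log T) / Real.sqrt T * T := by gcongr
    _ = (k : ℝ) ^ 2 * Real.sqrt (T * Real.log T) := by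
      rw [Real.sqrt_mul hT0.le]
      have hs : Real.sqrt T ≠ 0 := (Real.sqrt_pos.2 hT0).ne'
      field_simp
      rw [Real.sq_sqrt hT0.le]

end DataMarkets
open DataMarkets in
theorem mainTheorem6 :
    ∀ lam : ℝ, 0 < lam → ∃ C : ℝ, 0 < C ∧
      ∀ (n k T : ℕ), 1 ≤ k → 2 ≤ T →
      ∀ (M : DataMarket n k), M.Closeness (alphaStar k T) lam →
      ∀ (Sopt : Profile n k), M.IsWelfareOptimal (alphaStar k T) Sopt →
      ∀ (Ω : Type*) (mΩ : MeasurableSpace Ω) (μ : Measure Ω), IsProbabilityMeasure μ →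
      ∀ Z : ZoomingPlay M (alphaStar k T) lam T μ,
        Z.welfareRegret Sopt ≤
          C * ((n : ℝ) * (k : ℝ) ^ 2 * Real.sqrt ((T : ℝ) * Real.log T) +
            (n : ℝ) * (k : ℝ) ^ 3 * Real.log T ^ 2 * (2 : ℝ) ^ (3 * (k : ℝ) / 4)) := by
  intro lam hlam
  -- `23 = 22 + 1`: the two innermost shells contribute 22 and the uncharged externalities 1. The
  -- outer shells give `16000 / lam`; the failure event, or the trivial bound for small `T`, gives
  -- `9 lam`.
  refine ⟨23 + (16000 / lam + 9 * lam), by positivity, ?_⟩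
  intro n k T hk hT M hM Sopt _ Ω mΩ μ hμ Z
  have hα0 := alphaStar_nonneg k T
  have hα1 := alphaStar_le_one k T
  choose γd hdom hclose using hM
  have h1 := Z.welfareRegret_le hα0 hα1 Sopt hdom
  have h2 := Finset.sum_le_card_nsmul Finset.univ _ _
    (fun i _ => Z.integral_totalGap_le hα0 hα1 hlam hk hT i (hdom i) (hclose i))
  have h3 := mul_le_mul_of_nonneg_left (one_sub_alphaStar_mul_le k T hT) (Nat.cast_nonneg (α := ℝ) n)
  rw [nsmul_eq_mul, Finset.card_univ, Fintype.card_fin] at h2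
  have hX : 0 ≤ (n : ℝ) * ((k : ℝ) ^ 2 * Real.sqrt (T * Real.log T)) := by positivity
  have hY : 0 ≤ (n : ℝ) * ((k : ℝ) ^ 3 * Real.log T ^ 2 * (2 : ℝ) ^ (3 * (k : ℝ) / 4)) := by
    positivity
  have hc : 0 ≤ 16000 / lam + 9 * lam := by positivity
  have h4 := mul_nonneg hc hX
  calc _ ≤ _ := h1.trans (add_le_add h2 h3)
    _ ≤ _ := by linarith
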